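/- All graphs are finite and simple. For a graph $G$ with adjacency matrix $A$ let $S(G)=\mathbf J-\mathbf I-2A$ be its Seidel matrix; $\lambda_{\min}$ denotes the smallest eigenvalue, $\alpha$ the independence number, $\omega$ the clique number, $\dot\cup$ disjoint union, and $2K_2$ the disjoint union of two edges. **Theorem.** Let $G$ be a triangle-free graph with $\lambda_{\min}(S(G\,\dot\cup\,2K_2))\ge -5$ and $\alpha(G)\le 26$. For a vertex $x$ of $G$ let $a_x$ be its valency. Then (i) $G$ has at most $68$ vertices; (ii) if $G$ has at least $66$ vertices, then there is an edge $xy$ of $G$ with $a_x+a_y\le 20$. **Corollary.** A Seidel matrix is a real symmetric matrix $S$ with zero diagonal and all off-diagonal entries $\pm1$; its graph $G(S)$ has distinct $i,j$ adjacent if and only if $S_{ij}=-1$. The switching class $[S]$ consists of the graphs $G(D_USD_U)$, where $U$ ranges over the sets of indices and $D_U$ is the diagonal matrix with $(D_U)_{ii}=1$ for $i\in U$ and $-1$ otherwise. Let $\mathcal{Sw}(S)$ be the graph of the Seidel matrix $\begin{pmatrix}S&-S+\mathbf I\\-S+\mathbf I&S\end{pmatrix}$ and put $\omega([S])=\omega(\mathcal{Sw}(S))$,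 $\alpha([S])=\alpha(\mathcal{Sw}(S))$. Let $S$ be a Seidel matrix with $\lambda_{\min}(S)=-5$, $\omega([S])=4$ and $\alpha([S])\le 28$, let $G\in[S]$ with $\omega(G)=4$, let $B$ be the vertex set of a $4$-clique of $G$, and let $U\subseteq B$ with $|U|=2$. Let $\mathcal P$ be the corresponding $(4,2)$ pillar, that is, the set of vertices $y\notin B$ adjacent to every vertex of $U$ and to no vertex of $B\setminus U$, and let $G_{\mathcal P}$ be the subgraph of $G$ induced on $\mathcal P$. Then (i) $|\mathcal P|\le 68$; (ii) if $|\mathcal P|\ge 66$, then every edge $xy$ of $G_{\mathcal P}$ satisfies $a_x+a_y\le 20$, where $a_x,a_y$ are the valencies in $G_{\mathcal P}$. -/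

import Mathlib

/-- The Seidel matrix `S(G) = J - I - 2 A(G)` of a graph. -/
noncomputable def seidelMatrix {V : Type*} [Fintype V] [DecidableEq V] (G : SimpleGraph V) :
    Matrix V V ℝ :=
  letI := Classical.decRel G.Adj
  Matrix.of (fun _ _ => (1 : ℝ)) - 1 - (2 : ℝ) • G.adjMatrix ℝ

/-- A Seidel matrix: real symmetric, zero on the diagonal and `±1` off the diagonal. -/
structure IsSeidelMatrix {V : Type*} (S : Matrix V V ℝ) : Prop where
  isSymm : S.IsSymm
  diag_eq_zero : ∀ i, S i i = 0
  off_diag : ∀ i j, i ≠ j → S i j = 1 ∨ S i j = -1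

/-- The graph `G(S)` of a Seidel matrix `S`: distinct `i`, `j` are adjacent iff `S i j = -1`.
(`SimpleGraph.fromRel` symmetrizes the relation, which changes nothing for symmetric `S`.) -/
def graphOfSeidel {V : Type*} (S : Matrix V V ℝ) : SimpleGraph V :=
  SimpleGraph.fromRel fun i j => S i j = -1

/-- The smallest eigenvalue of a (nonempty) real symmetric matrix. Its spectrum is a finite
nonempty set of reals, so the infimum is attained. -/
noncomputable def smallestEigenvalue {V : Type*} [Fintype V] [DecidableEq V]
    (M : Matrix V V ℝ) : ℝ :=
  sInf (spectrum ℝ M)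

/-- The diagonal matrix `D_U` with entry `1` at the elements of `U` and `-1` elsewhere. -/
noncomputable def switchingDiagonal {V : Type*} [DecidableEq V] (U : Finset V) : Matrix V V ℝ :=
  Matrix.diagonal fun i => if i ∈ U then 1 else -1

/-- Switching with respect to `U`: `D_U S D_U`. -/
noncomputable def switchSeidel {V : Type*} [Fintype V] [DecidableEq V] (S : Matrix V V ℝ)
    (U : Finset V) : Matrix V V ℝ :=
  switchingDiagonal U * S * switchingDiagonal U

/-- The switching class `[S]`: all graphs obtained from `G(S)` by switching. -/
def switchingClass {V : Type*} [Fintype V] [DecidableEq V] (S : Matrix V V ℝ) :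
    Set (SimpleGraph V) :=
  {G | ∃ U : Finset V, G = graphOfSeidel (switchSeidel S U)}

/-- The switching graph `Sw(S)`: the graph of the Seidel matrix with blocks
`S`, `-S + I`, `-S + I`, `S`. -/
def switchingGraph {V : Type*} [DecidableEq V] (S : Matrix V V ℝ) : SimpleGraph (V ⊕ V) :=
  graphOfSeidel (Matrix.fromBlocks S (-S + 1) (-S + 1) S)

/-- The clique number `ω([S])` of the switching class. -/
noncomputable def switchingCliqueNum {V : Type*} [DecidableEq V] (S : Matrix V V ℝ) : ℕ :=
  (switchingGraph S).cliqueNum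

/-- The independence number `α([S])` of the switching class. -/
noncomputable def switchingIndepNum {V : Type*} [DecidableEq V] (S : Matrix V V ℝ) : ℕ :=
  (switchingGraph S).indepNum

/-- The disjoint union of two edges. -/
abbrev twoK2 : SimpleGraph (Fin 2 ⊕ Fin 2) :=
  (⊤ : SimpleGraph (Fin 2)) ⊕g (⊤ : SimpleGraph (Fin 2))

/-- The valency (degree) of a vertex of a finite graph. -/
noncomputable def valency {V : Type*} (G : SimpleGraph V) (x : V) : ℕ :=
  (G.neighborSet x).ncard

/-- The pillar of `U ⊆ B` with respect to the base `B`: the vertices outside `B` that are adjacent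
to every vertex of `U` and to no vertex of `B \ U`. If `B` is a base of order `4` and `U` has two
elements, this is a `(4,2)` pillar. -/
def pillar {V : Type*} [DecidableEq V] (G : SimpleGraph V) (B U : Finset V) : Set V :=
  {y | y ∉ B ∧ (∀ u ∈ U, G.Adj y u) ∧ ∀ u ∈ B \ U, ¬ G.Adj y u}

open Finset SimpleGraph

/-! Sixty-six vertices are already impossible, so both bounds hold with 65 and both statements about
66 or more vertices are vacuous. Minimising the form of `S + 5I` over constant weights on the four
vertices of `2K₂` leaves `2I - A + J/6 ≥ 0` on `G` (`formNonneg_of_seidelNonneg`). This condition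
and `α ≤ 26` pass to induced subgraphs, so exactly 66 vertices may be assumed
(`no_graph_on_sixty_six`).

Large degrees are excluded by the form. Testing it on a star bounds all degrees by 13. At degree 13
the star vector is isotropic, which forces a strongly regular graph with parameters (66, 13, 0, 3);
a fractional eigenvalue multiplicity excludes it. For degrees 5 to 12, the Schur complement of the
star shows that few non-neighbours of `x` have few common neighbours with `x`. Hence the degrees
around `x` have a large sum (`sum_degree_ge`), usually larger than the maximum degree permits.
Degrees 8 and 11 survive this count and need a walk count as well (`degree_ne_of_no_pred`).

Small degrees are excluded by independent sets. On vectors of sum zero the form is `2I - A`, whose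
null vectors live on affine Dynkin diagrams. If `G` contains such a diagram, the vertices far from
it span average degree at most 2 and so contain a large independent set; any 2-regular remainder is
controlled because isotropic vectors lie in the radical (`affine_bound`). This excludes vertices of
degree 4, quadrangles, and adjacent vertices of degree 3, in that order. What remains is a
triangle-free subcubic graph with no two adjacent cubic vertices; it has an independent set of at
least two fifths of its vertices, and `2 · 66 > 5 · 26`.

A pillar reduces to the same statement: switching with respect to `U` turns the base into `2K₂`
disjoint from the pillar. -/

/-- The quadratic form `2I - A + J/6` of a graph is positive semidefinite. -/
def FormNonneg {V : Type*} [Fintype V] (G : SimpleGraph V) [DecidableRel G.Adj] : Prop :=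
  ∀ v : V → ℝ, ∑ i, v i * ∑ j ∈ G.neighborFinset i, v j ≤ 2 * ∑ i, v i ^ 2 + (∑ i, v i) ^ 2 / 6

set_option linter.unusedSectionVars false

/-! ### The form on a star and its Schur complement. -/

section Star

variable {V : Type*} [Fintype V] [DecidableEq V] {G : SimpleGraph V} [DecidableRel G.Adj]

lemma sum_eq_star_sum (x : V) (f : V → ℝ) :
    ∑ i, f i = f x + ∑ u ∈ G.neighborFinset x, f u + ∑ i with i ≠ x ∧ ¬ G.Adj x i, f i := by
  rw [← add_sum_erase _ _ (mem_univ x),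
    ← sum_filter_add_sum_filter_not (univ.erase x) (fun i => G.Adj x i) f, ← add_assoc]
  congr 2
  · apply sum_congr _ fun _ _ => rfl
    ext i
    simp only [mem_filter, mem_erase, mem_univ, and_true, mem_neighborFinset]
    exact ⟨fun h => h.2, fun h => ⟨h.ne', h⟩⟩
  · ext i
    simp

/-- Walks of length two from `x`, grouped by their endpoint. -/
lemma sum_neighborFinset_comm (x : V) (f : V → ℝ) :
    ∑ u ∈ G.neighborFinset x, ∑ j ∈ G.neighborFinset u, f j =
      ∑ j, f j * (#(G.neighborFinset x ∩ G.neighborFinset j) : ℝ) := by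
  have h : ∀ u, ∑ j ∈ G.neighborFinset u, f j = ∑ j, if G.Adj u j then f j else 0 := by
    intro u
    rw [← sum_filter]
    exact sum_congr (by ext; simp) fun _ _ => rfl
  simp_rw [h]
  rw [sum_comm]
  refine sum_congr rfl fun j _ => ?_
  rw [← sum_filter, sum_const, nsmul_eq_mul, mul_comm]
  congr 3
  ext u
  simp [adj_comm]

lemma sum_mul_sum_comm (f g : V → ℝ) :
    ∑ i, f i * ∑ j ∈ G.neighborFinset i, g j = ∑ i, g i * ∑ j ∈ G.neighborFinset i, f j := by
  have h : ∀ (f : V → ℝ) u, ∑ j ∈ G.neighborFinset u, f j = ∑ j, if G.Adj u j then f j else 0 := by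
    intro f u
    rw [← sum_filter]
    exact sum_congr (by ext; simp) fun _ _ => rfl
  simp_rw [h, mul_sum]
  rw [sum_comm]
  refine sum_congr rfl fun j _ => sum_congr rfl fun i _ => ?_
  by_cases hij : G.Adj i j <;> simp [adj_comm, mul_comm]

lemma not_adj_of_adj_of_adj (hG : G.CliqueFree 3) {x u w : V} (hu : G.Adj x u) (hw : G.Adj x w) :
    ¬ G.Adj u w := fun h =>
  hG {x, u, w} (by rw [is3Clique_triple_iff]; exact ⟨hu, hw, h⟩)

/-- Positivity of the form on a star with centre `x`, extended by a weight `ω` on the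
non-neighbours of `x`. -/
lemma star_form_nonneg (hG : G.CliqueFree 3) (hq : FormNonneg G) (x : V) (ω : V → ℝ)
    (hx : ω x = 0) (hω : ∀ i, G.Adj x i → ω i = 0) (α β : ℝ) :
    0 ≤ 2 * α ^ 2 + 2 * G.degree x * β ^ 2 + 2 * ∑ i, ω i ^ 2
      - (∑ u ∈ G.neighborFinset x, (∑ j ∈ G.neighborFinset u, ω j) ^ 2) / 2
      + (α + G.degree x * β + (∑ u ∈ G.neighborFinset x, ∑ j ∈ G.neighborFinset u, ω j) / 2
          + ∑ i, ω i) ^ 2 / 6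
      - 2 * α * (G.degree x * β + (∑ u ∈ G.neighborFinset x, ∑ j ∈ G.neighborFinset u, ω j) / 2)
      - ∑ i, ω i * ∑ j ∈ G.neighborFinset i, ω j := by
  set σ : V → ℝ := fun i => ∑ j ∈ G.neighborFinset i, ω j with hσ
  set N := G.neighborFinset x with hN
  let p : V → ℝ := fun i => if i = x then α else 0
  -- The neighbours of `x` are pairwise non-adjacent, so the shift by `σ i / 2` completes the square
  -- against `ω`.
  let r : V → ℝ := fun i => if i ∈ N then β + σ i / 2 else 0
  have hxN : x ∉ N := by simp [hN]
  have hp : ∀ f : V → ℝ, ∑ i, p i * f i = α * f x := by intro f; simp [p]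
  have hr : ∀ f : V → ℝ, ∑ i, r i * f i = ∑ u ∈ N, (β + σ u / 2) * f u := by
    intro f
    simp only [r, ite_mul, zero_mul, sum_ite_mem, univ_inter]
  have hpsum : ∑ i, p i = α := by simp [p]
  have hrsum : ∑ i, r i = G.degree x * β + (∑ u ∈ N, σ u) / 2 := by
    have := hr 1
    simp only [Pi.one_apply, mul_one] at this
    rw [this, sum_add_distrib, sum_const, nsmul_eq_mul, ← sum_div, card_neighborFinset_eq_degree]
  have hωx : ∀ f : V → ℝ, (∀ i, i ≠ x → ¬ G.Adj x i → f i = 0) → ∑ i, ω i * f i = 0 := by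
    intro f hf
    refine sum_eq_zero fun i _ => ?_
    by_cases h1 : i = x
    · rw [h1, hx, zero_mul]
    by_cases h2 : G.Adj x i
    · rw [hω i h2, zero_mul]
    · rw [hf i h1 h2, mul_zero]
  have hLp : ∀ i, ∑ j ∈ G.neighborFinset i, p j = if i ∈ N then α else 0 := by
    intro i
    simp [p, hN, adj_comm]
  have hLrx : ∑ j ∈ N, r j = G.degree x * β + (∑ u ∈ N, σ u) / 2 := by
    rw [← hrsum]
    simp [r]
  have hLru : ∀ u ∈ N, ∑ j ∈ G.neighborFinset u, r j = 0 := by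
    intro u hu
    refine sum_eq_zero fun j hj => ?_
    simp only [hN, mem_neighborFinset] at hu hj
    have : j ∉ N := by
      rw [hN, mem_neighborFinset]
      exact fun h => not_adj_of_adj_of_adj hG hu h hj
    simp [r, this]
  have hσx : σ x = 0 := sum_eq_zero fun j hj => hω j (by simpa using hj)
  have e1 : ∑ i, p i * ∑ j ∈ G.neighborFinset i, p j = 0 := by rw [hp]; simp [hLp, hxN]
  have e2 : ∑ i, p i * ∑ j ∈ G.neighborFinset i, r j = α * (G.degree x * β + (∑ u ∈ N, σ u) / 2) := by
    rw [hp, ← hLrx]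
  have e3 : ∑ i, p i * ∑ j ∈ G.neighborFinset i, ω j = 0 := by
    rw [hp]; change α * σ x = 0; rw [hσx, mul_zero]
  have e4 : ∑ i, r i * ∑ j ∈ G.neighborFinset i, r j = 0 := by
    rw [hr]; exact sum_eq_zero fun u hu => by rw [hLru u hu, mul_zero]
  have e5 : ∑ i, r i * ∑ j ∈ G.neighborFinset i, ω j = β * ∑ u ∈ N, σ u + (∑ u ∈ N, σ u ^ 2) / 2 := by
    rw [hr, mul_sum, sum_div, ← sum_add_distrib]
    exact sum_congr rfl fun u _ => by simp only [hσ]; ring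
  have s1 : ∑ i, p i ^ 2 = α ^ 2 := by simp [p]
  have s2 : ∑ i, r i ^ 2 = G.degree x * β ^ 2 + β * ∑ u ∈ N, σ u + (∑ u ∈ N, σ u ^ 2) / 4 := by
    have := hr r
    simp only [← sq] at this
    rw [this, mul_sum, sum_div, ← card_neighborFinset_eq_degree, ← nsmul_eq_mul, ← hN, ← sum_const,
      ← sum_add_distrib, ← sum_add_distrib]
    refine sum_congr rfl fun u hu => ?_
    simp only [r, hu, if_true]
    ring
  have s3 : ∑ i, p i * r i = 0 := by rw [hp]; simp [r, hxN]
  have s4 : ∑ i, p i * ω i = 0 := by rw [hp, hx, mul_zero]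
  have s5 : ∑ i, r i * ω i = 0 := by
    rw [hr]
    exact sum_eq_zero fun u hu => by rw [hω u (by simpa [hN] using hu), mul_zero]
  have key := hq (fun i => p i + r i + ω i)
  have k1 : ∑ i, (p i + r i + ω i) * ∑ j ∈ G.neighborFinset i, (p j + r j + ω j) =
      2 * (α * (G.degree x * β + (∑ u ∈ N, σ u) / 2))
      + 2 * (β * ∑ u ∈ N, σ u + (∑ u ∈ N, σ u ^ 2) / 2)
      + ∑ i, ω i * ∑ j ∈ G.neighborFinset i, ω j := by
    simp only [sum_add_distrib, mul_add, add_mul]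
    rw [e1, e2, e3, e4, e5, sum_mul_sum_comm r p, sum_mul_sum_comm ω p, sum_mul_sum_comm ω r,
      e2, e3, e5]
    ring
  have k2 : ∑ i, (p i + r i + ω i) ^ 2 = α ^ 2 + (G.degree x * β ^ 2 + β * ∑ u ∈ N, σ u
      + (∑ u ∈ N, σ u ^ 2) / 4) + ∑ i, ω i ^ 2 := by
    have : ∀ i, (p i + r i + ω i) ^ 2 = p i ^ 2 + r i ^ 2 + ω i ^ 2 + 2 * (p i * r i)
        + 2 * (p i * ω i) + 2 * (r i * ω i) := fun i => by ring
    simp only [this, sum_add_distrib, ← mul_sum]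
    rw [s1, s2, s3, s4, s5]; ring
  have k3 : ∑ i, (p i + r i + ω i) = α + (G.degree x * β + (∑ u ∈ N, σ u) / 2) + ∑ i, ω i := by
    rw [sum_add_distrib, sum_add_distrib, hpsum, hrsum]
  rw [k1, k2, k3] at key
  have hc : ∀ u, ∑ j ∈ G.neighborFinset u, ω j = σ u := fun _ => rfl
  simp only [hc] at key ⊢
  linarith

/-- With weight `5a/13` at a centre of degree `a` and 1 on its neighbours, the form equals `2a(13 -
a)/13`. -/
lemma degree_le_thirteen (hG : G.CliqueFree 3) (hq : FormNonneg G) (x : V) : G.degree x ≤ 13 := by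
  have h := star_form_nonneg hG hq x 0 rfl (fun _ _ => rfl) (5 * G.degree x / 13) 1
  by_contra! h'
  have h' : (14 : ℝ) ≤ G.degree x := by exact_mod_cast h'
  simp only [Pi.zero_apply, sum_const_zero, mul_zero] at h
  ring_nf at h
  simp at h
  nlinarith

/-- The Schur complement of the form with respect to the star of `x`. -/
lemma star_schur (hG : G.CliqueFree 3) (hq : FormNonneg G) (x : V) (ω : V → ℝ)
    (hx : ω x = 0) (hω : ∀ i, G.Adj x i → ω i = 0) (hd : G.degree x < 13) :
    (∑ u ∈ G.neighborFinset x, (∑ j ∈ G.neighborFinset u, ω j) ^ 2)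
      + 2 * ∑ i, ω i * ∑ j ∈ G.neighborFinset i, ω j
      + (3 * ∑ i, ω i - ∑ u ∈ G.neighborFinset x, ∑ j ∈ G.neighborFinset u, ω j) ^ 2
        / (13 - G.degree x) ≤ 4 * ∑ i, ω i ^ 2 + (∑ i, ω i) ^ 2 := by
  set S := ∑ u ∈ G.neighborFinset x, ∑ j ∈ G.neighborFinset u, ω j
  set T := ∑ i, ω i
  have hB : (0 : ℝ) < 13 - G.degree x := by
    have : (G.degree x : ℝ) < 13 := by exact_mod_cast hd
    linarith
  -- Both partial derivatives of the star form vanish at this `b` and at the centre weight chosen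
  -- below, so the pair is the minimiser.
  obtain ⟨b, hb⟩ : ∃ b : ℝ, S = 3 * T + 2 * (13 - G.degree x) * b :=
    ⟨(S - 3 * T) / (2 * (13 - G.degree x)), by field_simp; ring⟩
  have h := star_form_nonneg hG hq x ω hx hω ((S + (2 * G.degree x + 4) * b) / 6) b
  have hdiv : (3 * T - S) ^ 2 / (13 - (G.degree x : ℝ)) = 4 * (13 - G.degree x) * b ^ 2 := by
    rw [hb]; field_simp; ring
  rw [hdiv]
  change 0 ≤ 2 * _ ^ 2 + _ + _ - _ + (_ + _ + S / 2 + T) ^ 2 / 6 - 2 * _ * (_ + S / 2) - _ at h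
  rw [hb] at h
  ring_nf at h ⊢
  linarith

end Star

/-! ### Common neighbours with a fixed vertex. -/

section Deficit

variable {V : Type*} [Fintype V] [DecidableEq V] (G : SimpleGraph V) [DecidableRel G.Adj]

/-- The vertices different from and not adjacent to `x`. -/
def nonNeighbors (x : V) : Finset V := {i | i ≠ x ∧ ¬ G.Adj x i}

/-- The number of common neighbours of two vertices. -/
def commonCard (x z : V) : ℕ := #(G.neighborFinset x ∩ G.neighborFinset z)

/-- The total amount by which the non-neighbours of `x` fall short of having `j` common
neighbours with `x`. -/
def deficit (x : V) (j : ℕ) : ℕ := ∑ z ∈ nonNeighbors G x, (j - commonCard G x z)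

/-- The total amount by which the non-neighbours of `x` exceed `j` common neighbours with `x`. -/
def excess (x : V) (j : ℕ) : ℕ := ∑ z ∈ nonNeighbors G x, (commonCard G x z - j)

variable {G}

lemma card_nonNeighbors (x : V) : #(nonNeighbors G x) + G.degree x + 1 = Fintype.card V := by
  have h := sum_eq_star_sum (G := G) x 1
  simp only [Pi.one_apply, sum_const, nsmul_eq_mul, mul_one, card_univ,
    card_neighborFinset_eq_degree] at h
  have h' : Fintype.card V = 1 + G.degree x + #(nonNeighbors G x) := by
    unfold nonNeighbors; exact_mod_cast h
  omega

lemma commonCard_of_adj (hG : G.CliqueFree 3) {x u : V} (h : G.Adj x u) : commonCard G x u = 0 := by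
  rw [commonCard, card_eq_zero, eq_empty_iff_forall_notMem]
  intro i hi
  simp only [mem_inter, mem_neighborFinset] at hi
  exact not_adj_of_adj_of_adj hG h hi.1 hi.2

lemma sum_nonNeighbors_mul_commonCard (hG : G.CliqueFree 3) (x : V) (f : V → ℝ) :
    ∑ u ∈ G.neighborFinset x, ∑ j ∈ G.neighborFinset u, f j =
      f x * G.degree x + ∑ z ∈ nonNeighbors G x, f z * commonCard G x z := by
  rw [sum_neighborFinset_comm, sum_eq_star_sum (G := G) x, inter_self,
    card_neighborFinset_eq_degree, sum_eq_zero (s := G.neighborFinset x), add_zero]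
  · rfl
  · intro u hu
    have := commonCard_of_adj hG ((mem_neighborFinset _ _ _).1 hu)
    rw [commonCard] at this
    simp [this]

lemma sum_degree_neighborFinset (hG : G.CliqueFree 3) (x : V) :
    ∑ u ∈ G.neighborFinset x, G.degree u =
      G.degree x + ∑ z ∈ nonNeighbors G x, commonCard G x z := by
  have := sum_nonNeighbors_mul_commonCard hG x 1
  simp only [Pi.one_apply, sum_const, nsmul_eq_mul, mul_one, one_mul,
    card_neighborFinset_eq_degree] at this
  exact_mod_cast this

/-- Bounds on the deficit become lower bounds on the degree sum around `x`, through `c + (j - c)⁺ =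
j + (c - j)⁺` summed over the non-neighbours. -/
lemma deficit_add_sum_degree (hG : G.CliqueFree 3) (x : V) (j : ℕ) :
    deficit G x j + ∑ u ∈ G.neighborFinset x, G.degree u =
      j * #(nonNeighbors G x) + excess G x j + G.degree x := by
  rw [sum_degree_neighborFinset hG, deficit, excess, add_left_comm, ← sum_add_distrib, mul_comm,
    ← smul_eq_mul, ← sum_const, ← sum_add_distrib, add_comm]
  congr 1
  exact sum_congr rfl fun z _ => by omega

/-- The Schur complement is tested on the weight `(j - c)⁺`, where `c` counts the common neighbours
with `x`. The edge term is nonnegative and is dropped; Cauchy–Schwarz over the neighbours of `x`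
reduces the squares to `s`, the sum of `(j - c)⁺ c`. The upper bound on `s` holds because `c ≤ j -
1` wherever the weight is nonzero. -/
lemma deficit_inequality (hG : G.CliqueFree 3) (hq : FormNonneg G) (x : V) (j : ℕ)
    (h0 : 0 < G.degree x) (hd : G.degree x < 13) :
    ∃ s : ℝ, 0 ≤ s ∧ s ≤ (j - 1) * deficit G x j ∧
      s ^ 2 / G.degree x + (3 * deficit G x j - s) ^ 2 / (13 - G.degree x) ≤
        4 * (j * deficit G x j - s) + (deficit G x j : ℝ) ^ 2 := by
  let ω : V → ℝ := fun z => if z ∈ nonNeighbors G x then ((j - commonCard G x z : ℕ) : ℝ) else 0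
  have hω0 : ∀ z, 0 ≤ ω z := fun z => by simp only [ω]; split_ifs <;> positivity
  have hsch := star_schur hG hq x ω (by simp [ω, nonNeighbors])
    (fun i hi => by simp [ω, nonNeighbors, hi]) hd
  have hT : ∑ i, ω i = deficit G x j := by
    simp [ω, deficit]
  set s : ℝ := ∑ z ∈ nonNeighbors G x, ((j - commonCard G x z : ℕ) : ℝ) * commonCard G x z with hs
  have hS : ∑ u ∈ G.neighborFinset x, ∑ i ∈ G.neighborFinset u, ω i = s := by
    rw [sum_nonNeighbors_mul_commonCard hG, hs]
    have : ω x = 0 := by simp [ω, nonNeighbors]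
    rw [this, zero_mul, zero_add]
    exact sum_congr rfl fun z hz => by simp [ω, hz]
  have hQ : ∑ i, ω i ^ 2 = j * deficit G x j - s := by
    have : ∀ i, ω i ^ 2 = if i ∈ nonNeighbors G x then ((j - commonCard G x i : ℕ) : ℝ) ^ 2 else 0 := by
      intro i; simp only [ω]; split_ifs <;> simp
    simp only [this, sum_ite_mem, univ_inter, hs, deficit, Nat.cast_sum]
    rw [mul_sum, ← sum_sub_distrib]
    refine sum_congr rfl fun z _ => ?_
    rcases le_total j (commonCard G x z) with h | h
    · simp [h]
    · rw [Nat.cast_sub h]; ring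
  have hE : 0 ≤ ∑ i, ω i * ∑ j ∈ G.neighborFinset i, ω j :=
    sum_nonneg fun i _ => mul_nonneg (hω0 i) (sum_nonneg fun _ _ => hω0 _)
  have hcs : s ^ 2 / G.degree x ≤
      ∑ u ∈ G.neighborFinset x, (∑ i ∈ G.neighborFinset u, ω i) ^ 2 := by
    rw [← hS, div_le_iff₀ (by exact_mod_cast h0), mul_comm, ← card_neighborFinset_eq_degree]
    exact sq_sum_le_card_mul_sum_sq
  rw [hS, hT, hQ] at hsch
  refine ⟨s, sum_nonneg fun _ _ => by positivity, ?_, by linarith⟩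
  rw [deficit, Nat.cast_sum, mul_sum]
  refine sum_le_sum fun z _ => ?_
  rcases le_or_gt j (commonCard G x z) with h | h
  · simp [h]
  · rw [mul_comm]
    gcongr
    have : (commonCard G x z : ℝ) + 1 ≤ j := by exact_mod_cast h
    linarith

lemma deficit_one_le (hG : G.CliqueFree 3) (hq : FormNonneg G) (x : V)
    (h0 : 5 ≤ G.degree x) (hd : G.degree x < 13) :
    deficit G x 1 * (G.degree x - 4) ≤ 4 * (13 - G.degree x) := by
  obtain ⟨s, hs0, hs1, h⟩ := deficit_inequality hG hq x 1 (by omega) hd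
  have : s = 0 := by simp at hs1; linarith
  subst this
  generalize deficit G x 1 = D at *
  generalize G.degree x = a at *
  rcases Nat.eq_zero_or_pos D with rfl | hD
  · simp
  have hD : (0 : ℝ) < D := by exact_mod_cast hD
  zify [show 4 ≤ a by omega, hd.le]
  have hB : (0 : ℝ) < 13 - a := by
    have : (a : ℝ) < 13 := by exact_mod_cast hd
    linarith
  simp only [ne_eq, OfNat.ofNat_ne_zero, not_false_eq_true, zero_pow, zero_div, zero_add,
    sub_zero, Nat.cast_one, one_mul] at h
  rw [div_le_iff₀ hB] at h
  have : (D : ℝ) * (D * (a - 4)) ≤ D * (4 * (13 - a)) := by nlinarith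
  exact_mod_cast le_of_mul_le_mul_left this hD

/-- For large deficit `D` the extreme case is `s = D`, every deficient vertex being one short. There
the inequality gives `D ≤ 36`, `13D/30 ≤ 4` and `12D/11 ≤ 4` respectively. -/
lemma deficit_two_le (hG : G.CliqueFree 3) (hq : FormNonneg G) (x : V) :
    (G.degree x = 9 → deficit G x 2 ≤ 36) ∧ (G.degree x = 10 → deficit G x 2 ≤ 9) ∧
      (G.degree x = 11 → deficit G x 2 ≤ 3) := by
  refine ⟨fun ha => ?_, fun ha => ?_, fun ha => ?_⟩ <;>
  · obtain ⟨s, hs0, hs1, h⟩ := deficit_inequality hG hq x 2 (by omega) (by omega)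
    rw [ha] at h
    generalize deficit G x 2 = D at *
    by_contra! hD
    have hD : ((_ : ℕ) : ℝ) ≤ D := Nat.cast_le.2 (Nat.succ_le_of_lt hD)
    norm_num at h hs1
    push_cast at hD
    nlinarith [mul_nonneg hs0 (sub_nonneg.2 hs1), mul_nonneg (sub_nonneg.2 hD) (sub_nonneg.2 hs1), mul_nonneg (sub_nonneg.2 hD) hs0]

lemma deficit_three_lt (hG : G.CliqueFree 3) (hq : FormNonneg G) (x : V)
    (ha : G.degree x = 12) : deficit G x 3 < 15 := by
  obtain ⟨s, hs0, hs1, h⟩ := deficit_inequality hG hq x 3 (by omega) (by omega)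
  rw [ha] at h
  generalize deficit G x 3 = D at *
  by_contra! hD
  have hD : ((15 : ℕ) : ℝ) ≤ D := Nat.cast_le.2 hD
  norm_num at h hs1
  push_cast at hD
  nlinarith [mul_nonneg hs0 (sub_nonneg.2 hs1), mul_nonneg (sub_nonneg.2 hD) (sub_nonneg.2 hs1), mul_nonneg (sub_nonneg.2 hD) hs0]

end Deficit

/-! ### Excluding degrees from 5 to 12 on 66 vertices. -/

section HighDegree

variable {V : Type*} [Fintype V] [DecidableEq V] {G : SimpleGraph V} [DecidableRel G.Adj]

lemma sum_degree_le {k : ℕ} (hk : ∀ v, G.degree v ≤ k) (x : V) :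
    ∑ u ∈ G.neighborFinset x, G.degree u ≤ G.degree x * k := by
  rw [← card_neighborFinset_eq_degree, ← smul_eq_mul]
  exact sum_le_card_nsmul _ _ _ fun u _ => hk u

/-- Each constant is `j(65 - a) + a` minus the largest deficit allowed at degree `a`, with `j = 1`
for `a ≤ 8`, `j = 2` for `9 ≤ a ≤ 11` and `j = 3` for `a = 12`. -/
lemma sum_degree_ge (hG : G.CliqueFree 3) (hq : FormNonneg G) (hn : Fintype.card V = 66) (x : V) :
    (G.degree x = 5 → 33 ≤ ∑ u ∈ G.neighborFinset x, G.degree u) ∧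
    (G.degree x = 6 → 51 ≤ ∑ u ∈ G.neighborFinset x, G.degree u) ∧
    (G.degree x = 7 → 57 ≤ ∑ u ∈ G.neighborFinset x, G.degree u) ∧
    (G.degree x = 8 → 60 ≤ ∑ u ∈ G.neighborFinset x, G.degree u) ∧
    (G.degree x = 9 → 85 ≤ ∑ u ∈ G.neighborFinset x, G.degree u) ∧
    (G.degree x = 10 → 111 ≤ ∑ u ∈ G.neighborFinset x, G.degree u) ∧
    (G.degree x = 11 → 116 ≤ ∑ u ∈ G.neighborFinset x, G.degree u) ∧
    (G.degree x = 12 → 157 ≤ ∑ u ∈ G.neighborFinset x, G.degree u) := by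
  have h1 := deficit_add_sum_degree hG x 1
  have h2 := deficit_add_sum_degree hG x 2
  have h3 := deficit_add_sum_degree hG x 3
  have hw := card_nonNeighbors (G := G) x
  have d1 := deficit_one_le hG hq x
  have d2 := deficit_two_le hG hq x
  have d3 := deficit_three_lt hG hq x
  refine ⟨?_, ?_, ?_, ?_, ?_, ?_, ?_, ?_⟩ <;>
  · intro ha
    rw [ha] at h1 h2 h3 hw d1 d2 d3
    omega

/-- The Schur complement inequality for the all-ones weight on the non-neighbours of `x`. -/
lemma sum_degree_nonNeighbors_le (hG : G.CliqueFree 3) (hq : FormNonneg G) (x : V)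
    (hd : G.degree x < 13) :
    ∑ u ∈ G.neighborFinset x, ((G.degree u : ℝ) - 1) ^ 2
      + 2 * (∑ z ∈ nonNeighbors G x, (G.degree z : ℝ)
          - (∑ u ∈ G.neighborFinset x, (G.degree u : ℝ) - G.degree x))
      + (3 * #(nonNeighbors G x) - (∑ u ∈ G.neighborFinset x, (G.degree u : ℝ) - G.degree x)) ^ 2
        / (13 - G.degree x) ≤ 4 * #(nonNeighbors G x) + (#(nonNeighbors G x) : ℝ) ^ 2 := by
  let ω : V → ℝ := fun z => if z ∈ nonNeighbors G x then 1 else 0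
  have hsch := star_schur hG hq x ω (by simp [ω, nonNeighbors])
    (fun i hi => by simp [ω, nonNeighbors, hi]) hd
  have hT : ∑ i, ω i = #(nonNeighbors G x) := by simp [ω]
  have hQ : ∑ i, ω i ^ 2 = #(nonNeighbors G x) := by simp [ω]
  have hsum : ∀ v, ∑ j ∈ G.neighborFinset v, ω j = G.degree v - commonCard G x v
      - if G.Adj v x then 1 else 0 := by
    intro v
    have : ∀ j, ω j = 1 - (if j ∈ G.neighborFinset x then 1 else 0) - if j = x then 1 else 0 := by
      intro j
      by_cases h1 : j = x
      · simp [ω, nonNeighbors, h1]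
      · by_cases h2 : G.Adj x j <;> simp [ω, nonNeighbors, h1, h2]
    simp only [this, sum_sub_distrib, sum_const, card_neighborFinset_eq_degree]
    rw [sum_ite_mem, inter_comm]
    simp [commonCard]
  have hσ : ∀ u ∈ G.neighborFinset x, ∑ j ∈ G.neighborFinset u, ω j = G.degree u - 1 := by
    intro u hu
    have hu' := (mem_neighborFinset _ _ _).1 hu
    rw [hsum, commonCard_of_adj hG hu', if_pos hu'.symm]
    simp
  have hS : ∑ u ∈ G.neighborFinset x, ∑ i ∈ G.neighborFinset u, ω i =
      ∑ u ∈ G.neighborFinset x, (G.degree u : ℝ) - G.degree x := by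
    rw [sum_congr rfl hσ, sum_sub_distrib]
    simp
  have hC := sum_nonNeighbors_mul_commonCard hG x ω
  have hE : ∑ i, ω i * ∑ j ∈ G.neighborFinset i, ω j = ∑ z ∈ nonNeighbors G x, (G.degree z : ℝ)
          - (∑ u ∈ G.neighborFinset x, (G.degree u : ℝ) - G.degree x) := by
    have hx : ω x = 0 := by simp [ω, nonNeighbors]
    rw [← hS, hC, hx, zero_mul, zero_add, ← sum_sub_distrib]
    simp only [ω, ite_mul, one_mul, zero_mul, sum_ite_mem, univ_inter]
    refine sum_congr rfl fun z hz => ?_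
    have h1 := hsum z
    simp only [ω, sum_ite_mem] at h1 ⊢
    rw [h1]
    have : ¬ G.Adj z x := fun h => (mem_filter.1 hz).2.2 h.symm
    simp [this, hz]
  rw [hS, hT, hQ, hE, sum_congr rfl fun u hu => by rw [hσ u hu]] at hsch
  exact hsch

/-- Counting walks of length two from a vertex of maximum degree `k`, when no vertex has degree
`k - 1`. -/
lemma walk_count (hG : G.CliqueFree 3) {k L : ℕ} (hk : ∀ v, G.degree v ≤ k)
    (hk' : ∀ v, G.degree v + 1 ≠ k)
    (hL : ∀ v, G.degree v = k → L ≤ ∑ u ∈ G.neighborFinset v, G.degree u) (hkL : k ≤ L)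
    (x : V) (hx : G.degree x = k) (j : ℕ) :
    (2 * k) * (L - k) ≤ (k * k - ∑ u ∈ G.neighborFinset x, G.degree u) * (L - k)
      + 2 * (j * ∑ z ∈ nonNeighbors G x, G.degree z + k * excess G x j) := by
  set N := G.neighborFinset x with hN
  set g := #{u ∈ N | G.degree u = k} with hg
  have hNk : #N = k := by rw [hN, card_neighborFinset_eq_degree, hx]
  -- A neighbour not of degree `k` has degree at most `k - 2`, and so costs at least 2.
  have hS : ∑ u ∈ N, G.degree u + 2 * k ≤ k * k + 2 * g := by
    have : ∑ u ∈ N, (G.degree u + 2) ≤ ∑ u ∈ N, (k + if G.degree u = k then 2 else 0) := by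
      refine sum_le_sum fun u _ => ?_
      have := hk u
      have := hk' u
      split_ifs <;> omega
    simpa [sum_add_distrib, hNk, ← sum_filter, ← hg, mul_comm] using this
  have hwalk : ∑ u ∈ N, ∑ z ∈ G.neighborFinset u, G.degree z =
      k * k + ∑ z ∈ nonNeighbors G x, G.degree z * commonCard G x z := by
    have := sum_nonNeighbors_mul_commonCard hG x (fun z => (G.degree z : ℝ))
    rw [hx] at this
    exact_mod_cast this
  have hlow : k * k + g * (L - k) ≤ ∑ u ∈ N, ∑ z ∈ G.neighborFinset u, G.degree z := by
    have : ∑ u ∈ N, (k + if G.degree u = k then L - k else 0) ≤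
        ∑ u ∈ N, ∑ z ∈ G.neighborFinset u, G.degree z := by
      refine sum_le_sum fun u hu => ?_
      split_ifs with h
      · have := hL u h
        omega
      -- For the other neighbours only the step back to `x` is counted, which contributes `k`.
      · have hxu : x ∈ G.neighborFinset u := by
          rw [mem_neighborFinset, adj_comm]
          exact (mem_neighborFinset _ _ _).1 hu
        have := single_le_sum (f := fun z => G.degree z) (fun _ _ => Nat.zero_le _) hxu
        simp only [hx] at this
        omega
    simpa [sum_add_distrib, hNk, ← sum_filter, ← hg, mul_comm] using this
  have hup : ∑ z ∈ nonNeighbors G x, G.degree z * commonCard G x z ≤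
      j * ∑ z ∈ nonNeighbors G x, G.degree z + k * excess G x j := by
    rw [excess, mul_sum, mul_sum, ← sum_add_distrib]
    refine sum_le_sum fun z _ => ?_
    rcases le_total (commonCard G x z) j with h | h
    · have := Nat.mul_le_mul_left (G.degree z) h
      rw [mul_comm j]
      omega
    · obtain ⟨t, ht⟩ := Nat.exists_eq_add_of_le h
      have := Nat.mul_le_mul_right t (hk z)
      rw [ht, Nat.add_sub_cancel_left, mul_add, mul_comm j]
      omega
  have h1 : 2 * k ≤ (k * k - ∑ u ∈ N, G.degree u) + 2 * g := by omega
  have h2 := Nat.mul_le_mul_right (L - k) h1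
  rw [add_mul, mul_assoc 2 g] at h2
  omega

/-- The all-ones Schur inequality bounds the degree sum over the non-neighbours of `x` from above,
and this is too small for the walk count. -/
lemma degree_ne_of_no_pred (hG : G.CliqueFree 3) (hq : FormNonneg G) (hn : Fintype.card V = 66)
    {k : ℕ} (hk : ∀ v, G.degree v ≤ k) (hk' : ∀ v, G.degree v + 1 ≠ k)
    (h8 : k = 8 ∨ k = 11) (x : V) : G.degree x ≠ k := by
  intro hx
  have hL : ∀ v, G.degree v = k → (if k = 8 then 60 else 116) ≤
      ∑ u ∈ G.neighborFinset v, G.degree u := by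
    intro v hv
    obtain ⟨-, -, -, h1, -, -, h2, -⟩ := sum_degree_ge hG hq hn v
    rcases h8 with rfl | rfl
    · exact h1 hv
    · exact h2 hv
  have h1 := walk_count hG hk hk' hL (by split_ifs <;> omega) x hx (if k = 8 then 1 else 2)
  have h2 := sum_degree_nonNeighbors_le hG hq x (by omega)
  have h3 := deficit_add_sum_degree hG x (if k = 8 then 1 else 2)
  have hw := card_nonNeighbors (G := G) x
  have d1 := deficit_one_le hG hq x
  have d2 := deficit_two_le hG hq x
  have hle := sum_degree_le hk x
  -- Tangent line of `(d - 1)²` at `d = k`.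
  have hsq : ∑ u ∈ G.neighborFinset x, ((G.degree u : ℝ) - 1) ^ 2 ≥
      2 * (k - 1) * ∑ u ∈ G.neighborFinset x, (G.degree u : ℝ) + G.degree x * (1 - (k : ℝ) ^ 2) := by
    rw [mul_sum, ← card_neighborFinset_eq_degree, ← nsmul_eq_mul, ← sum_const, ← sum_add_distrib]
    refine sum_le_sum fun u _ => ?_
    nlinarith [sq_nonneg ((k : ℝ) - G.degree u)]
  have hge : (if k = 8 then 60 else 116) ≤ ∑ u ∈ G.neighborFinset x, G.degree u := hL x hx
  have c1 : ∑ u ∈ G.neighborFinset x, (G.degree u : ℝ) =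
    ((∑ u ∈ G.neighborFinset x, G.degree u : ℕ) : ℝ) := by push_cast; rfl
  have c2 : ∑ u ∈ nonNeighbors G x, (G.degree u : ℝ) =
    ((∑ u ∈ nonNeighbors G x, G.degree u : ℕ) : ℝ) := by push_cast; rfl
  rw [c1, c2] at h2
  rw [c1] at hsq
  have hw' : #(nonNeighbors G x) = 65 - k := by omega
  rw [hw'] at h2 h3
  rw [hx] at h2 h3 hle hsq d1 d2
  generalize ∑ u ∈ G.neighborFinset x, G.degree u = S at *
  generalize ∑ u ∈ nonNeighbors G x, G.degree u = D at *
  generalize ∑ u ∈ G.neighborFinset x, ((G.degree u : ℝ) - 1) ^ 2 = Q at *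
  rcases h8 with rfl | rfl
  · norm_num at h1 h2 h3 d1 hle hsq hge
    -- The value 276 is attained at `S = 64`, where all neighbours have degree 8; smaller `S` gives
    -- a smaller bound.
    have : D ≤ 276 := by
      suffices (D : ℝ) ≤ 276 by exact_mod_cast this
      have : (S : ℝ) ≤ 64 := by exact_mod_cast hle
      nlinarith [sq_nonneg ((S : ℝ) - 64)]
    omega
  · norm_num at h1 h2 h3 d2 hle hsq hge
    obtain ⟨e, rfl⟩ : ∃ e, S = 116 + e := ⟨S - 116, by omega⟩
    -- The bound on `D` is concave in `S`; this is its tangent at `S = 121`, that is at `e = 5`.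
    have : (D : ℝ) ≤ 450 - 17 * (5 - e) := by
      have : (e : ℝ) ≤ 5 := by exact_mod_cast (by omega : e ≤ 5)
      push_cast at *
      nlinarith
    have : D + 17 * (5 - e) ≤ 450 := by
      rw [← Nat.cast_le (α := ℝ)]
      push_cast [Nat.cast_sub (by omega : e ≤ 5)]
      linarith
    omega

/-- The maximum degree descends from 12. Most degrees fall because `sum_degree_ge` exceeds degree
times maximum. Degree 10 fails even under maximum 11 (111 > 110) and degree 7 under maximum 8 (57 >
56), which supplies the missing predecessor for 11 and 8. -/
lemma degree_le_four (hG : G.CliqueFree 3) (hq : FormNonneg G) (hn : Fintype.card V = 66)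
    (h13 : ∀ x, G.degree x ≠ 13) (x : V) : G.degree x ≤ 4 := by
  have hge := sum_degree_ge hG hq hn
  have step : ∀ k, (∀ v, G.degree v ≤ k + 1) → (∀ v, G.degree v ≠ k + 1) →
      ∀ v, G.degree v ≤ k := fun k h1 h2 v => by
    have := h1 v; have := h2 v; omega
  have h12 := step 12 (degree_le_thirteen hG hq) h13
  have h11 := step 11 h12 fun v hv => by
    have := sum_degree_le h12 v; have := hge v; rw [hv] at *; omega
  have h10 := step 10 h11 (degree_ne_of_no_pred hG hq hn h11 (fun v hv => by
    have hv : G.degree v = 10 := by omega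
    have := sum_degree_le h11 v; have := hge v; rw [hv] at *; omega) (by simp))
  have h9 := step 9 h10 fun v hv => by
    have := sum_degree_le h10 v; have := hge v; rw [hv] at *; omega
  have h8 := step 8 h9 fun v hv => by
    have := sum_degree_le h9 v; have := hge v; rw [hv] at *; omega
  have h7 := step 7 h8 (degree_ne_of_no_pred hG hq hn h8 (fun v hv => by
    have hv : G.degree v = 7 := by omega
    have := sum_degree_le h8 v; have := hge v; rw [hv] at *; omega) (by simp))
  have h6 := step 6 h7 fun v hv => by
    have := sum_degree_le h7 v; have := hge v; rw [hv] at *; omega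
  have h5 := step 5 h6 fun v hv => by
    have := sum_degree_le h6 v; have := hge v; rw [hv] at *; omega
  exact step 4 h5 (fun v hv => by
    have := sum_degree_le h5 v; have := hge v; rw [hv] at *; omega) x

end HighDegree

/-! ### Degree 13 and the strongly regular graph (66, 13, 0, 3). -/

section DegreeThirteen

variable {V : Type*} [Fintype V] [DecidableEq V] {G : SimpleGraph V} [DecidableRel G.Adj]

lemma eq_zero_of_forall_linear_add_sq_nonneg {k q : ℝ} (h : ∀ t : ℝ, 0 ≤ t * k + t ^ 2 * q) :
    k = 0 := by
  by_contra hk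
  have h1 := h (-k / (|q| + 1))
  have hpos : 0 < |q| + 1 := by positivity
  have h2 : -k / (|q| + 1) * k + (-k / (|q| + 1)) ^ 2 * q =
      k ^ 2 * (q - (|q| + 1)) / (|q| + 1) ^ 2 := by field_simp; ring
  rw [h2, le_div_iff₀ (by positivity), zero_mul] at h1
  have h3 : 0 < k ^ 2 := by positivity
  nlinarith [le_abs_self q]

/-- At degree 13 the star vector with weights 5 and 1 is isotropic, so adding `t` at `z` must have
no linear term; its coefficient is `6 - 2c`. -/
lemma commonCard_eq_three (hG : G.CliqueFree 3) (hq : FormNonneg G) {x z : V}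
    (hx : G.degree x = 13) (hz : z ∈ nonNeighbors G x) : commonCard G x z = 3 := by
  have hz' := (mem_filter.1 hz).2
  have key : ∀ t : ℝ, 0 ≤ t * (6 - 2 * commonCard G x z) + t ^ 2 *
      (2 - commonCard G x z / 2 + (1 + commonCard G x z / 2 : ℝ) ^ 2 / 6) := by
    intro t
    let ω : V → ℝ := fun i => if i = z then t else 0
    have h := star_form_nonneg hG hq x ω (by simp [ω, hz'.1.symm])
      (fun i hi => by
        have : i ≠ z := by rintro rfl; exact hz'.2 hi
        simp [ω, this]) 5 1
    have h1 : ∑ i, ω i = t := by simp [ω]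
    have h2 : ∑ i, ω i ^ 2 = t ^ 2 := by simp [ω]
    have h3 : ∀ u, ∑ j ∈ G.neighborFinset u, ω j = if G.Adj u z then t else 0 := by
      intro u; simp [ω]
    have h4 : ∑ i, ω i * ∑ j ∈ G.neighborFinset i, ω j = 0 := by
      refine sum_eq_zero fun i _ => ?_
      rw [h3]
      by_cases hi : i = z
      · simp [hi]
      · simp [ω, hi]
    have h5 : ∀ r : ℝ, ∑ u ∈ G.neighborFinset x, (if G.Adj u z then r else 0) =
        commonCard G x z * r := by
      intro r
      rw [← sum_filter, sum_const, nsmul_eq_mul, commonCard]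
      congr 3
      ext u
      simp [adj_comm]
    have h6 : ∑ u ∈ G.neighborFinset x, (∑ j ∈ G.neighborFinset u, ω j) ^ 2 =
        commonCard G x z * t ^ 2 := by
      rw [← h5]
      refine sum_congr rfl fun u _ => ?_
      rw [h3]; split_ifs <;> simp
    simp_rw [h6, h1, h2, h4, h3, h5] at h
    rw [hx] at h
    push_cast at h
    nlinarith
  have := eq_zero_of_forall_linear_add_sq_nonneg key
  have h : (commonCard G x z : ℝ) = 3 := by linarith
  exact_mod_cast h

/-- The degrees around `x` sum to `13 + 3 · 52 = 13 · 13`, which leaves no slack below the maximum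
13. -/
lemma degree_eq_thirteen_of_adj (hG : G.CliqueFree 3) (hq : FormNonneg G)
    (hn : Fintype.card V = 66) {x u : V} (hx : G.degree x = 13) (hu : G.Adj x u) :
    G.degree u = 13 := by
  have h1 := sum_degree_neighborFinset hG x
  rw [sum_congr rfl fun z hz => commonCard_eq_three hG hq hx hz] at h1
  have hw := card_nonNeighbors (G := G) x
  have h2 : ∑ u ∈ G.neighborFinset x, G.degree u = ∑ u ∈ G.neighborFinset x, 13 := by
    rw [h1, sum_const, sum_const, card_neighborFinset_eq_degree, smul_eq_mul, smul_eq_mul]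
    omega
  exact (sum_eq_sum_iff_of_le fun v _ => degree_le_thirteen hG hq v).1 h2 u (by simpa using hu)

lemma isRegular_thirteen (hG : G.CliqueFree 3) (hq : FormNonneg G)
    (hn : Fintype.card V = 66) {x : V} (hx : G.degree x = 13) (z : V) : G.degree z = 13 := by
  by_cases h1 : z = x
  · rwa [h1]
  by_cases h2 : G.Adj x z
  · exact degree_eq_thirteen_of_adj hG hq hn hx h2
  have h3 := commonCard_eq_three hG hq hx (z := z) (by simp [nonNeighbors, h1, h2])
  obtain ⟨u, hu⟩ : (G.neighborFinset x ∩ G.neighborFinset z).Nonempty := by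
    rw [← card_pos, ← commonCard, h3]; norm_num
  simp only [mem_inter, mem_neighborFinset] at hu
  exact degree_eq_thirteen_of_adj hG hq hn
    (degree_eq_thirteen_of_adj hG hq hn hx hu.1) hu.2.symm

lemma exists_nat_trace_of_isIdempotentElem {P : Matrix V V ℝ} (hP : IsIdempotentElem P) :
    ∃ r : ℕ, P.trace = r := by
  have h : IsIdempotentElem (Matrix.toLin' P) := by
    rw [IsIdempotentElem, Module.End.mul_eq_comp, ← Matrix.toLin'_mul, hP.eq]
  refine ⟨Module.finrank ℝ (LinearMap.range (Matrix.toLin' P)), ?_⟩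
  rw [← LinearMap.IsProj.trace (LinearMap.IsIdempotentElem.isProj_range _ h), Matrix.trace_toLin'_eq]

/-- There is no strongly regular graph with parameters `(66, 13, 0, 3)`, so no vertex has
degree `13`. -/
lemma degree_ne_thirteen (hG : G.CliqueFree 3) (hq : FormNonneg G)
    (hn : Fintype.card V = 66) (x : V) : G.degree x ≠ 13 := by
  intro hx
  have hreg := isRegular_thirteen hG hq hn hx
  set A := G.adjMatrix ℝ with hA
  set J : Matrix V V ℝ := Matrix.of fun _ _ => 1 with hJ
  have hA2 : A * A = (10 : ℝ) • 1 - (3 : ℝ) • A + (3 : ℝ) • J := by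
    ext i j
    have h1 : (A * A) i j = commonCard G i j := by
      rw [hA, adjMatrix_mul_apply, commonCard]
      simp only [adjMatrix_apply, sum_boole]
      congr 2
      ext u
      simp [adj_comm]
    rw [h1]
    simp only [Matrix.add_apply, Matrix.sub_apply, Matrix.smul_apply, hA, hJ, adjMatrix_apply,
      Matrix.of_apply, smul_eq_mul, Matrix.one_apply]
    by_cases hij : i = j
    · subst hij
      rw [commonCard, inter_self, card_neighborFinset_eq_degree, hreg]
      norm_num
    · by_cases h2 : G.Adj i j
      · rw [commonCard_of_adj hG h2]; simp [hij, h2]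
      · rw [commonCard_eq_three hG hq (hreg i) (by simp [nonNeighbors, Ne.symm hij, h2])]
        simp [hij, h2]
  have hAJ : A * J = (13 : ℝ) • J := by
    ext i j
    simp [hA, hJ, hreg]
  have hJA : J * A = (13 : ℝ) • J := by
    ext i j
    simp [hA, hJ, hreg]
  have hJJ : J * J = (66 : ℝ) • J := by
    ext i j
    simp [hJ, Matrix.mul_apply, hn]
  -- The adjacency eigenvalues are 13, 2 and -5; this is the projection onto the eigenspace of -5,
  -- and its trace `66 · 13 / 42` is not an integer.
  have hP : IsIdempotentElem ((1 / 42 : ℝ) • ((12 : ℝ) • (1 : Matrix V V ℝ) - (6 : ℝ) • A + J)) := by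
    rw [IsIdempotentElem]
    simp only [Matrix.smul_mul, Matrix.mul_smul, add_mul, mul_add, sub_mul, mul_sub, one_mul,
      mul_one, hA2, hAJ, hJA, hJJ]
    module
  obtain ⟨r, hr⟩ := exists_nat_trace_of_isIdempotentElem hP
  have ht : ((1 / 42 : ℝ) • ((12 : ℝ) • (1 : Matrix V V ℝ) - (6 : ℝ) • A + J)).trace = 143 / 7 := by
    simp [hA, hn, hJ, Matrix.trace]
    norm_num
  rw [ht] at hr
  have : (143 : ℝ) = (r * 7 : ℕ) := by push_cast; linarith
  have : 143 = r * 7 := by exact_mod_cast this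
  omega

end DegreeThirteen

/-! ### Independent sets in sparse triangle-free graphs. -/

section Independent

variable {V : Type*} [Fintype V] [DecidableEq V] {G : SimpleGraph V} [DecidableRel G.Adj]

/-- The neighbours of `v` inside `s`. -/
def nbrsIn (G : SimpleGraph V) [DecidableRel G.Adj] (s : Finset V) (v : V) : Finset V :=
  s.filter (G.Adj v)

lemma mem_nbrsIn {s : Finset V} {v u : V} : u ∈ nbrsIn G s v ↔ u ∈ s ∧ G.Adj v u := by
  simp [nbrsIn]

lemma nbrsIn_mono {s t : Finset V} (h : s ⊆ t) (v : V) : nbrsIn G s v ⊆ nbrsIn G t v :=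
  filter_subset_filter _ h

lemma isIndepSet_insert {s I : Finset V} {v : V} (hI : G.IsIndepSet I)
    (hIs : I ⊆ s \ insert v (nbrsIn G s v)) : G.IsIndepSet (insert v I : Finset V) := by
  rw [coe_insert, isIndepSet_iff, Set.pairwise_insert]
  refine ⟨hI, fun u hu _ => ?_⟩
  have := mem_sdiff.1 (hIs hu)
  simp only [mem_insert, mem_nbrsIn, not_or, not_and] at this
  have h := this.2.2 this.1
  exact ⟨h, fun h' => h h'.symm⟩

/-- Greedy deletion: a vertex of degree at most 1 is picked at a cost of two vertices. Otherwise
some `x` has only neighbours of degree 2. Picking one of them, `u`, deletes three vertices including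
`x`, after which another neighbour `w` has degree at most 1. This picks two of at most five
vertices. -/
lemma exists_indep_of_pairwise_no_adj_cubic (hG : G.CliqueFree 3) (s : Finset V)
    (h3 : ∀ v ∈ s, #(nbrsIn G s v) ≤ 3)
    (hadj : ∀ v ∈ s, ∀ u ∈ s, G.Adj v u → #(nbrsIn G s v) = 3 → #(nbrsIn G s u) ≠ 3) :
    ∃ I ⊆ s, G.IsIndepSet I ∧ 2 * #s ≤ 5 * #I := by
  induction s using Finset.strongInduction with
  | H s ih =>
  have ih' : ∀ t : Finset V, t ⊂ s → ∃ I ⊆ t, G.IsIndepSet I ∧ 2 * #t ≤ 5 * #I := by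
    intro t ht
    have hle : ∀ v, #(nbrsIn G t v) ≤ #(nbrsIn G s v) := fun v =>
      card_le_card (nbrsIn_mono ht.1 v)
    refine ih t ht (fun v hv => (hle v).trans (h3 v (ht.1 hv))) ?_
    intro v hv u hu huv e1 e2
    have a1 := hle v
    have a2 := hle u
    have b1 := h3 v (ht.1 hv)
    have b2 := h3 u (ht.1 hu)
    exact hadj v (ht.1 hv) u (ht.1 hu) huv (by omega) (by omega)
  rcases s.eq_empty_or_nonempty with rfl | ⟨x₀, hx₀⟩
  · exact ⟨∅, by simp, by simp [isIndepSet_iff], by simp⟩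
  by_cases hlow : ∃ v ∈ s, #(nbrsIn G s v) ≤ 1
  · obtain ⟨v, hv, hv1⟩ := hlow
    obtain ⟨I, hIs, hI, hc⟩ := ih' (s \ insert v (nbrsIn G s v))
      (sdiff_ssubset (insert_subset hv (filter_subset _ _)) (insert_nonempty _ _))
    have hvI : v ∉ I := fun h => by simpa using hIs h
    refine ⟨insert v I, insert_subset hv (hIs.trans sdiff_subset), isIndepSet_insert hI hIs, ?_⟩
    rw [card_insert_of_notMem hvI]
    have := le_card_sdiff (insert v (nbrsIn G s v)) s
    have := card_insert_le v (nbrsIn G s v)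
    omega
  push Not at hlow
  obtain ⟨x, hx, hxu⟩ : ∃ x ∈ s, ∀ u ∈ s, G.Adj x u → #(nbrsIn G s u) = 2 := by
    by_cases h : ∃ x ∈ s, #(nbrsIn G s x) = 3
    · obtain ⟨x, hx, hx3⟩ := h
      refine ⟨x, hx, fun u hu hxu => ?_⟩
      have := hadj x hx u hu hxu hx3
      have := h3 u hu
      have := hlow u hu
      omega
    · push Not at h
      refine ⟨x₀, hx₀, fun u hu _ => ?_⟩
      have := h u hu
      have := h3 u hu
      have := hlow u hu
      omega
  obtain ⟨u, hu, w, hw, huw⟩ := one_lt_card.1 (hlow x hx)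
  rw [mem_nbrsIn] at hu hw
  have hu2 := hxu u hu.1 hu.2
  have hw2 := hxu w hw.1 hw.2
  have hnuw : ¬ G.Adj u w := not_adj_of_adj_of_adj hG hu.2 hw.2
  set t := s \ insert u (nbrsIn G s u) with ht
  have hwt : w ∈ t := by
    simp only [ht, mem_sdiff, mem_insert, mem_nbrsIn, not_or, not_and]
    exact ⟨hw.1, huw.symm, fun _ => hnuw⟩
  have hts : t ⊆ s := sdiff_subset
  have htc : #s ≤ #t + 3 := by
    have h := le_card_sdiff (insert u (nbrsIn G s u)) s
    rw [← ht] at h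
    have := card_insert_le u (nbrsIn G s u)
    omega
  have hxt : x ∉ t := by simp [ht, mem_nbrsIn, hx, hu.2.symm]
  have hwt1 : #(nbrsIn G t w) ≤ 1 := by
    have : nbrsIn G t w ⊂ nbrsIn G s w := by
      rw [ssubset_iff_of_subset (nbrsIn_mono hts w)]
      exact ⟨x, mem_nbrsIn.2 ⟨hx, hw.2.symm⟩, fun h => hxt (mem_nbrsIn.1 h).1⟩
    have := card_lt_card this
    omega
  obtain ⟨I, hIs, hI, hc⟩ := ih' (t \ insert w (nbrsIn G t w))
    ((sdiff_subset).trans_ssubset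
      (sdiff_ssubset (insert_subset hu.1 (filter_subset _ _)) (insert_nonempty _ _)))
  have hwI : w ∉ I := fun h => by simpa using hIs h
  have hI2 : insert w I ⊆ t := insert_subset hwt (hIs.trans sdiff_subset)
  have huI : u ∉ insert w I := fun h => by simpa [ht] using hI2 h
  refine ⟨insert u (insert w I), insert_subset hu.1 (hI2.trans hts),
    isIndepSet_insert (isIndepSet_insert hI hIs) hI2, ?_⟩
  rw [card_insert_of_notMem huI, card_insert_of_notMem hwI]
  have := le_card_sdiff (insert w (nbrsIn G t w)) t
  have := card_insert_le w (nbrsIn G t w)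
  omega

/-- If every subset of `s` spans a graph of average degree at most `2`, then `s` has an independent
set of size about half of `s`, up to a fifth of a `2`-regular part. -/
lemma exists_indep_of_average_degree_le_two (hG : G.CliqueFree 3) (s : Finset V)
    (havg : ∀ t ⊆ s, ∑ v ∈ t, #(nbrsIn G t v) ≤ 2 * #t) :
    ∃ R ⊆ s, (∀ v ∈ R, #(nbrsIn G R v) = 2) ∧
      ∃ I ⊆ s, G.IsIndepSet I ∧ 5 * #s ≤ 10 * #I + #R := by
  induction s using Finset.strongInduction with
  | H s ih =>
  by_cases hlow : ∃ v ∈ s, #(nbrsIn G s v) ≤ 1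
  · obtain ⟨v, hv, hv1⟩ := hlow
    obtain ⟨R, hRs, hR, I, hIs, hI, hc⟩ := ih (s \ insert v (nbrsIn G s v))
      (sdiff_ssubset (insert_subset hv (filter_subset _ _)) (insert_nonempty _ _))
      (fun t ht => havg t (ht.trans sdiff_subset))
    have hvI : v ∉ I := fun h => by simpa using hIs h
    refine ⟨R, hRs.trans sdiff_subset, hR, insert v I,
      insert_subset hv (hIs.trans sdiff_subset), isIndepSet_insert hI hIs, ?_⟩
    rw [card_insert_of_notMem hvI]
    have := le_card_sdiff (insert v (nbrsIn G s v)) s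
    have := card_insert_le v (nbrsIn G s v)
    omega
  push Not at hlow
  have h2 : ∀ v ∈ s, 2 = #(nbrsIn G s v) := by
    refine (sum_eq_sum_iff_of_le fun v hv => hlow v hv).1 (le_antisymm (sum_le_sum hlow) ?_)
    have := havg s subset_rfl
    rw [sum_const, smul_eq_mul]
    omega
  obtain ⟨I, hIs, hI, hc⟩ := exists_indep_of_pairwise_no_adj_cubic hG s
    (fun v hv => by rw [← h2 v hv]; norm_num)
    (fun v hv _ _ _ h => by rw [← h2 v hv] at h; norm_num at h)
  exact ⟨s, subset_rfl, fun v hv => (h2 v hv).symm, I, hIs, hI, by omega⟩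

end Independent

/-! ### Affine diagrams as null vectors of `2I - A`. -/

section Affine

variable {V : Type*} [Fintype V] [DecidableEq V] {G : SimpleGraph V} [DecidableRel G.Adj]

/-- The vertices that lie outside `F` and have no neighbour in `F`. -/
def farFrom (G : SimpleGraph V) [DecidableRel G.Adj] (F : Finset V) : Finset V :=
  {v | v ∉ F ∧ ∀ u ∈ F, ¬ G.Adj v u}

lemma sum_neighborFinset_indicator (t : Finset V) (v : V) :
    ∑ j ∈ G.neighborFinset v, (if j ∈ t then (1 : ℝ) else 0) = #(nbrsIn G t v) := by
  rw [sum_boole, nbrsIn]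
  congr 2
  ext; simp [and_comm]

variable {F : Finset V} {e : V → ℕ}

/-- The vector `(∑ e) 1_t - |t| e` sums to zero, and the form takes the expected value on it. -/
lemma affine_vector_identities (hF : ∀ v ∉ F, e v = 0)
    (he : ∀ v ∈ F, ∑ j ∈ G.neighborFinset v, e j = 2 * e v) {t : Finset V}
    (ht : t ⊆ farFrom G F) (g : V → ℝ)
    (hg : g = fun v => ((∑ i, e i : ℕ) : ℝ) * (if v ∈ t then 1 else 0) - #t * e v) :
    ∑ i, g i = 0 ∧
      2 * ∑ i, g i ^ 2 - ∑ i, g i * ∑ j ∈ G.neighborFinset i, g j =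
        ((∑ i, e i : ℕ) : ℝ) ^ 2 * (2 * #t - ∑ v ∈ t, (#(nbrsIn G t v) : ℝ)) := by
  have htF : ∀ v ∈ t, e v = 0 := fun v hv => hF v (mem_filter.1 (ht hv)).2.1
  have htL : ∀ v ∈ t, ∑ j ∈ G.neighborFinset v, (e j : ℝ) = 0 := by
    intro v hv
    refine sum_eq_zero fun j hj => ?_
    rw [Nat.cast_eq_zero]
    apply hF
    intro hjF
    exact (mem_filter.1 (ht hv)).2.2 j hjF (by simpa using hj)
  set m : ℝ := ((∑ i, e i : ℕ) : ℝ) with hm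
  let χ : V → ℝ := fun v => if v ∈ t then 1 else 0
  have hχ : ∀ f : V → ℝ, ∑ i, χ i * f i = ∑ i ∈ t, f i := by
    intro f; simp [χ]
  have a1 : ∑ i, χ i * ∑ j ∈ G.neighborFinset i, χ j = ∑ v ∈ t, (#(nbrsIn G t v) : ℝ) := by
    rw [hχ]; exact sum_congr rfl fun v _ => sum_neighborFinset_indicator t v
  have a2 : ∑ i, χ i * ∑ j ∈ G.neighborFinset i, (e j : ℝ) = 0 := by
    rw [hχ]; exact sum_eq_zero htL
  have a3 : ∑ i, (e i : ℝ) * ∑ j ∈ G.neighborFinset i, χ j = 0 := by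
    rw [sum_mul_sum_comm, a2]
  have a4 : ∑ i, (e i : ℝ) * ∑ j ∈ G.neighborFinset i, (e j : ℝ) = 2 * ∑ i, (e i : ℝ) ^ 2 := by
    rw [mul_sum]
    refine sum_congr rfl fun v _ => ?_
    by_cases hv : v ∈ F
    · have := he v hv
      rw [← Nat.cast_sum, this]; push_cast; ring
    · simp [hF v hv]
  have a5 : ∑ i, χ i * (e i : ℝ) = 0 := by
    rw [hχ]; exact sum_eq_zero fun v hv => by simp [htF v hv]
  have a6 : ∑ i, χ i ^ 2 = #t := by simp [χ]
  have hg' : ∀ v, g v = m * χ v - #t * e v := fun v => by rw [hg]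
  constructor
  · have : ∑ i, χ i = #t := by simp [χ]
    simp only [hg', sum_sub_distrib, ← mul_sum, this, hm, Nat.cast_sum]
    ring
  · have h1 : ∑ i, g i ^ 2 = m ^ 2 * #t + #t ^ 2 * ∑ i, (e i : ℝ) ^ 2 := by
      have : ∀ i, g i ^ 2 = m ^ 2 * χ i ^ 2 + #t ^ 2 * (e i : ℝ) ^ 2
          - 2 * m * #t * (χ i * e i) := fun i => by rw [hg']; ring
      simp only [this, sum_sub_distrib, sum_add_distrib, ← mul_sum, a5, a6]
      ring
    have h2 : ∑ i, g i * ∑ j ∈ G.neighborFinset i, g j =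
        m ^ 2 * ∑ v ∈ t, (#(nbrsIn G t v) : ℝ) + #t ^ 2 * (2 * ∑ i, (e i : ℝ) ^ 2) := by
      have : ∀ i, g i * ∑ j ∈ G.neighborFinset i, g j =
          m ^ 2 * (χ i * ∑ j ∈ G.neighborFinset i, χ j)
          - m * #t * (χ i * ∑ j ∈ G.neighborFinset i, (e j : ℝ))
          - m * #t * ((e i : ℝ) * ∑ j ∈ G.neighborFinset i, χ j)
          + #t ^ 2 * ((e i : ℝ) * ∑ j ∈ G.neighborFinset i, (e j : ℝ)) := fun i => by
        simp only [hg', sum_sub_distrib, ← mul_sum]; ring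
      simp only [this, sum_sub_distrib, sum_add_distrib, ← mul_sum, a1, a2, a3, a4]
      ring
    rw [h1, h2]
    ring

/-- The sum-zero vector of `affine_vector_identities` removes the `J` term, so the average degree
bound is exactly the sign of the form there. -/
lemma average_degree_le_two_of_affine (hq : FormNonneg G) (hF : ∀ v ∉ F, e v = 0)
    (he : ∀ v ∈ F, ∑ j ∈ G.neighborFinset v, e j = 2 * e v) (hm : 0 < ∑ i, e i)
    {t : Finset V} (ht : t ⊆ farFrom G F) : ∑ v ∈ t, #(nbrsIn G t v) ≤ 2 * #t := by
  obtain ⟨h1, h2⟩ := affine_vector_identities hF he ht _ rfl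
  have := hq (fun v => ((∑ i, e i : ℕ) : ℝ) * (if v ∈ t then 1 else 0) - #t * e v)
  rw [h1] at this
  have hm' : (0 : ℝ) < ((∑ i, e i : ℕ) : ℝ) ^ 2 := by positivity
  have h3 : (0 : ℝ) ≤ 2 * #t - ∑ v ∈ t, (#(nbrsIn G t v) : ℝ) := by
    refine nonneg_of_mul_nonneg_right ?_ hm'
    rw [← h2]
    linarith
  have h4 : ((∑ v ∈ t, #(nbrsIn G t v) : ℕ) : ℝ) ≤ ((2 * #t : ℕ) : ℝ) := by
    push_cast; linarith
  exact_mod_cast h4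

/-- All isotropic vectors of the form that are orthogonal to each other are proportional. -/
lemma card_mul_sum_eq_of_affine (hq : FormNonneg G) (hF : ∀ v ∉ F, e v = 0)
    (he : ∀ v ∈ F, ∑ j ∈ G.neighborFinset v, e j = 2 * e v)
    {R : Finset V} (hR : R ⊆ farFrom G F) (hR2 : ∀ v ∈ R, #(nbrsIn G R v) = 2)
    {w : V} (hwF : w ∉ F) (hwR : w ∉ R) :
    #R * ∑ j ∈ G.neighborFinset w, e j = (∑ i, e i) * #(nbrsIn G R w) := by
  set g : V → ℝ := fun v => ((∑ i, e i : ℕ) : ℝ) * (if v ∈ R then 1 else 0) - #R * e v with hg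
  obtain ⟨h1, h2⟩ := affine_vector_identities hF he hR g hg
  have h3 : ∑ v ∈ R, (#(nbrsIn G R v) : ℝ) = 2 * #R := by
    rw [sum_congr rfl fun v hv => by rw [hR2 v hv]]
    simp [mul_comm]
  rw [h3, sub_self, mul_zero] at h2
  have hgw : g w = 0 := by simp [hg, hwR, hF w hwF]
  set L := ∑ j ∈ G.neighborFinset w, g j with hL
  have hL' : L = ((∑ i, e i : ℕ) : ℝ) * #(nbrsIn G R w)
      - #R * ((∑ j ∈ G.neighborFinset w, e j : ℕ) : ℝ) := by
    rw [← sum_neighborFinset_indicator, hL, Nat.cast_sum (G.neighborFinset w), mul_sum, mul_sum,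
      ← sum_sub_distrib]
  -- `g` is isotropic, so the form on `g` plus `τ` at `w` has no constant term; `13/6 = 2 + 1/6` is
  -- the diagonal entry of the form.
  have key : ∀ τ : ℝ, 0 ≤ τ * (-2 * L) + τ ^ 2 * (13 / 6) := by
    intro τ
    let p : V → ℝ := fun v => if v = w then τ else 0
    have hp : ∀ f : V → ℝ, ∑ i, p i * f i = τ * f w := by intro f; simp [p]
    have h := hq (fun v => g v + p v)
    have b1 : ∑ i, (g i + p i) = τ := by
      rw [sum_add_distrib, h1]; simp [p]
    have b2 : ∑ i, (g i + p i) ^ 2 = ∑ i, g i ^ 2 + τ ^ 2 := by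
      have : ∀ i, (g i + p i) ^ 2 = g i ^ 2 + 2 * (p i * g i) + p i * p i := fun i => by ring
      simp only [this, sum_add_distrib, ← mul_sum, hp, hgw]
      simp [p, sq]
    have b3 : ∑ i, (g i + p i) * ∑ j ∈ G.neighborFinset i, (g j + p j) =
        ∑ i, g i * ∑ j ∈ G.neighborFinset i, g j + 2 * τ * L := by
      have hpp : ∑ j ∈ G.neighborFinset w, p j = 0 :=
        sum_eq_zero fun j hj => by
          have : G.Adj w j := by simpa using hj
          simp [p, this.ne']
      simp only [sum_add_distrib, mul_add, add_mul]
      rw [sum_mul_sum_comm g p, hp, hp, ← hL, hpp]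
      ring
    rw [b1, b2, b3] at h
    linarith
  have h0 := eq_zero_of_forall_linear_add_sq_nonneg key
  have h5 : ((#R * ∑ j ∈ G.neighborFinset w, e j : ℕ) : ℝ) =
      (((∑ i, e i) * #(nbrsIn G R w) : ℕ) : ℝ) := by
    rw [Nat.cast_mul, Nat.cast_mul]; linarith
  exact_mod_cast h5

/-- The bound on the number of vertices obtained from an affine subgraph on the vertex set `F`. -/
lemma affine_bound (hG : G.CliqueFree 3) (hq : FormNonneg G) {α k M K : ℕ}
    (hα : ∀ I : Finset V, G.IsIndepSet I → #I ≤ α) (hk : ∀ v, G.degree v ≤ k + 1)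
    (hF : ∀ v ∉ F, e v = 0) (hF1 : ∀ v ∈ F, 1 ≤ e v)
    (he : ∀ v ∈ F, ∑ j ∈ G.neighborFinset v, e j = 2 * e v)
    (hM : ∑ v ∈ F, e v = M) (hM0 : 0 < M) (hK : ∑ v ∈ F, #(G.neighborFinset v \ F) ≤ K)
    {J : Finset V} (hJF : J ⊆ F) (hJ : G.IsIndepSet J) :
    5 * Fintype.card V + 10 * #J ≤ 10 * α + 5 * #F + 5 * K + M * k ∨
      4 * Fintype.card V + 10 * #J ≤ 10 * α + 4 * #F := by
  have hsum : ∑ i, e i = M := by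
    rw [← hM]
    exact (sum_subset (subset_univ F) fun v _ hv => hF v hv).symm
  obtain ⟨R, hRs, hR, I, hIs, hI, hc⟩ := exists_indep_of_average_degree_le_two hG (farFrom G F)
    fun t ht => average_degree_le_two_of_affine hq hF he (by omega) ht
  have hIJ : #I + #J ≤ α := by
    rw [← card_union_of_disjoint]
    · apply hα
      rw [coe_union, isIndepSet_iff, Set.pairwise_union]
      refine ⟨hI, hJ, fun a ha b hb _ => ?_⟩
      have := (mem_filter.1 (hIs ha)).2.2 b (hJF hb)
      exact ⟨this, fun h => this h.symm⟩
    · rw [Finset.disjoint_left]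
      exact fun a ha hb => (mem_filter.1 (hIs ha)).2.1 (hJF hb)
  set O := F.biUnion fun v => G.neighborFinset v \ F with hO
  have hOK : #O ≤ K := card_biUnion_le.trans hK
  have hcover : Fintype.card V ≤ #(farFrom G F) + #F + #O := by
    rw [← card_univ]
    have : (univ : Finset V) ⊆ farFrom G F ∪ F ∪ O := by
      intro v _
      by_cases h1 : v ∈ F
      · simp [h1]
      by_cases h2 : ∀ u ∈ F, ¬ G.Adj v u
      · simp only [mem_union]
        exact Or.inl (Or.inl (mem_filter.2 ⟨mem_univ _, h1, h2⟩))
      · push Not at h2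
        obtain ⟨u, hu, hvu⟩ := h2
        refine mem_union_right _ (mem_biUnion.2 ⟨u, hu, ?_⟩)
        simp [h1, hvu.symm]
    refine (card_le_card this).trans ((card_union_le _ _).trans ?_)
    have := card_union_le (farFrom G F) F
    omega
  -- If nothing outside `F` touches `F`, then only `#R ≤ n - #F` is known. Otherwise a vertex `w`
  -- touching `F` bounds `#R`, having at most `k` neighbours left for `R`.
  rcases O.eq_empty_or_nonempty with hOe | ⟨w, hw⟩
  · right
    rw [hOe, card_empty] at hcover
    have := card_le_card hRs
    omega
  · left
    obtain ⟨u, hu, hwu⟩ := mem_biUnion.1 hw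
    simp only [mem_sdiff, mem_neighborFinset] at hwu
    have hwR : w ∉ R := fun h => (mem_filter.1 (hRs h)).2.2 u hu hwu.1.symm
    have h1 := card_mul_sum_eq_of_affine hq hF he hRs hR hwu.2 hwR
    rw [hsum] at h1
    have h2 : 1 ≤ ∑ j ∈ G.neighborFinset w, e j :=
      (hF1 u hu).trans (single_le_sum (fun _ _ => Nat.zero_le _)
        (by simpa using hwu.1.symm))
    have h3 : #(nbrsIn G R w) ≤ k := by
      have : nbrsIn G R w ⊂ G.neighborFinset w := by
        rw [ssubset_iff_of_subset fun v hv => by simpa using (mem_nbrsIn.1 hv).2]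
        refine ⟨u, by simpa using hwu.1.symm, fun h => ?_⟩
        exact (mem_filter.1 (hRs (mem_nbrsIn.1 h).1)).2.1 hu
      have := card_lt_card this
      rw [card_neighborFinset_eq_degree] at this
      have := hk w
      omega
    have h4 : #R ≤ M * k := by
      calc #R ≤ #R * ∑ j ∈ G.neighborFinset w, e j := Nat.le_mul_of_pos_right _ h2
        _ = M * #(nbrsIn G R w) := h1
        _ ≤ M * k := Nat.mul_le_mul_left _ h3
    omega

end Affine

/-! ### Excluding degree 4, quadrangles and adjacent cubic vertices. -/

section LowDegree

variable {V : Type*} [Fintype V] [DecidableEq V] {G : SimpleGraph V} [DecidableRel G.Adj]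

lemma isIndepSet_neighborFinset (hG : G.CliqueFree 3) (x : V) :
    G.IsIndepSet (G.neighborFinset x : Set V) := by
  intro a ha b hb _
  simp only [coe_neighborFinset, mem_neighborSet] at ha hb
  exact not_adj_of_adj_of_adj hG ha hb

lemma degree_ne_four (hG : G.CliqueFree 3) (hq : FormNonneg G) (hn : Fintype.card V = 66)
    (hα : ∀ I : Finset V, G.IsIndepSet I → #I ≤ 26) (h4 : ∀ v, G.degree v ≤ 4) (x : V) :
    G.degree x ≠ 4 := by
  intro hx
  set N := G.neighborFinset x with hN
  have hNc : #N = 4 := by rw [hN, card_neighborFinset_eq_degree, hx]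
  have hxN : x ∉ N := by simp [hN]
  let e : V → ℕ := fun v => if v = x then 2 else if v ∈ N then 1 else 0
  have heN : ∀ v ∈ N, e v = 1 := fun v hv => by
    have : v ≠ x := fun h => hxN (h ▸ hv)
    simp [e, this, hv]
  have hex : e x = 2 := by simp [e]
  have hsN : ∑ v ∈ N, e v = 4 := by rw [sum_congr rfl heN]; simp [hNc]
  -- Affine `D₄`: centre 2, leaves 1. Each leaf sends at most three edges out. The alternatives read
  -- 370 ≤ 363 and 304 ≤ 280.
  have := affine_bound (F := insert x N) (e := e) (M := 6) (K := 12) (J := N) (k := 3) hG hq hα h4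
    (fun v hv => by
      rw [mem_insert, not_or] at hv
      simp [e, hv.1, hv.2])
    (fun v hv => by
      rcases mem_insert.1 hv with rfl | hv
      · omega
      · rw [heN v hv])
    (fun v hv => by
      rcases mem_insert.1 hv with rfl | hv
      · rw [← hN, hsN, hex]
      · have hxv : x ∈ G.neighborFinset v := by simpa [adj_comm, hN] using hv
        have hz : ∑ j ∈ (G.neighborFinset v).erase x, e j = 0 := by
          refine sum_eq_zero fun j hj => ?_
          simp only [mem_erase, mem_neighborFinset] at hj
          have : j ∉ N := fun h =>
            not_adj_of_adj_of_adj hG (by simpa [hN] using hv) (by simpa [hN] using h) hj.2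
          simp [e, hj.1, this]
        rw [heN v hv, ← add_sum_erase _ _ hxv, hex, hz])
    (by rw [sum_insert hxN, hex, hsN])
    (by norm_num)
    (by
      rw [sum_insert hxN, sdiff_eq_empty_iff_subset.2 (subset_insert _ _), card_empty, zero_add]
      calc ∑ v ∈ N, #(G.neighborFinset v \ insert x N) ≤ ∑ v ∈ N, 3 := by
            refine sum_le_sum fun v hv => ?_
            have hxv : x ∈ G.neighborFinset v := by simpa [adj_comm, hN] using hv
            have h1 : G.neighborFinset v \ insert x N ⊆ (G.neighborFinset v).erase x := by
              rw [← sdiff_singleton_eq_erase]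
              exact sdiff_subset_sdiff subset_rfl (by simp)
            have h2 := card_le_card h1
            rw [card_erase_of_mem hxv, card_neighborFinset_eq_degree] at h2
            have := h4 v
            omega
        _ = 12 := by simp [hNc])
    (subset_insert _ _) (isIndepSet_neighborFinset hG x)
  rw [card_insert_of_notMem hxN, hNc, hn] at this
  omega

/-- A quadrangle yields a contradiction for subcubic graphs. -/
lemma not_adj_of_quadrangle (hG : G.CliqueFree 3) (hq : FormNonneg G) (hn : Fintype.card V = 66)
    (hα : ∀ I : Finset V, G.IsIndepSet I → #I ≤ 26) (h3 : ∀ v, G.degree v ≤ 3) {x y u v : V}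
    (hxy : G.Adj x y) (hxu : G.Adj x u) (hyv : G.Adj y v) (hu : u ≠ y) (hv : v ≠ x) :
    ¬ G.Adj u v := by
  intro huv
  have hxv : ¬ G.Adj x v := fun h => not_adj_of_adj_of_adj hG hxy h hyv
  have huy : ¬ G.Adj u y := fun h => not_adj_of_adj_of_adj hG hxu hxy h
  have a1 := hxy.ne
  have a2 := hxu.ne
  have a3 := hyv.ne
  have a4 := huv.ne
  have hFc : #({x, y, u, v} : Finset V) = 4 := by
    rw [card_insert_of_notMem (by simp [a1, a2, hv.symm]),
      card_insert_of_notMem (by simp [a3, hu.symm]), card_pair a4]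
  set F : Finset V := {x, y, u, v} with hF
  have hdeg : ∀ w ∈ F, #(G.neighborFinset w ∩ F) = 2 := by
    have e1 : G.neighborFinset x ∩ F = {y, u} := by
      ext j; simp only [hF, mem_inter, mem_neighborFinset, mem_insert, mem_singleton]
      constructor
      · rintro ⟨h, rfl | rfl | rfl | rfl⟩ <;> simp_all
      · rintro (rfl | rfl) <;> simp_all
    have e2 : G.neighborFinset y ∩ F = {x, v} := by
      ext j; simp only [hF, mem_inter, mem_neighborFinset, mem_insert, mem_singleton]
      constructor
      · rintro ⟨h, rfl | rfl | rfl | rfl⟩ <;> simp_all [adj_comm]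
      · rintro (rfl | rfl) <;> simp_all [adj_comm]
    have e3 : G.neighborFinset u ∩ F = {x, v} := by
      ext j; simp only [hF, mem_inter, mem_neighborFinset, mem_insert, mem_singleton]
      constructor
      · rintro ⟨h, rfl | rfl | rfl | rfl⟩ <;> simp_all [adj_comm]
      · rintro (rfl | rfl) <;> simp_all [adj_comm]
    have e4 : G.neighborFinset v ∩ F = {y, u} := by
      ext j; simp only [hF, mem_inter, mem_neighborFinset, mem_insert, mem_singleton]
      constructor
      · rintro ⟨h, rfl | rfl | rfl | rfl⟩ <;> simp_all [adj_comm]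
      · rintro (rfl | rfl) <;> simp_all [adj_comm]
    intro w hw
    simp only [hF, mem_insert, mem_singleton] at hw
    rcases hw with rfl | rfl | rfl | rfl
    · rw [e1, card_pair hu.symm]
    · rw [e2, card_pair hv.symm]
    · rw [e3, card_pair hv.symm]
    · rw [e4, card_pair hu.symm]
  -- Affine `A₃`, all multiplicities 1, with opposite corners as independent set. The alternatives
  -- read 350 ≤ 308 and 284 ≤ 276.
  have := affine_bound (F := F) (e := fun w => if w ∈ F then 1 else 0) (M := 4) (K := 4)
    (J := {x, v}) (k := 2) hG hq hα h3
    (fun w hw => by simp [hw]) (fun w hw => by simp [hw])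
    (fun w hw => by
      rw [sum_ite_mem, sum_const, hdeg w hw]; simp [hw])
    (by rw [sum_ite_mem, inter_self]; simp [hFc]) (by norm_num)
    (by
      calc ∑ w ∈ F, #(G.neighborFinset w \ F) ≤ ∑ w ∈ F, 1 := by
            refine sum_le_sum fun w hw => ?_
            have h1 := card_inter_add_card_sdiff (G.neighborFinset w) F
            rw [card_neighborFinset_eq_degree, hdeg w hw] at h1
            have := h3 w
            omega
        _ = 4 := by simp [hFc])
    (by intro j; simp only [hF, mem_insert, mem_singleton]; tauto)
    (by
      rw [coe_pair, isIndepSet_iff, Set.pairwise_pair]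
      exact fun _ => ⟨hxv, fun h => hxv h.symm⟩)
  rw [card_pair hv.symm, hFc, hn] at this
  omega

/-- Multiplicities of the affine diagram with two adjacent branch vertices `x` and `y`. -/
def doubleStar (G : SimpleGraph V) [DecidableRel G.Adj] (x y v : V) : ℕ :=
  if v = x ∨ v = y then 2 else if v ∈ G.neighborFinset x ∪ G.neighborFinset y then 1 else 0

lemma doubleStar_comm (x y : V) : doubleStar G x y = doubleStar G y x := by
  ext v
  simp only [doubleStar, union_comm, or_comm]

section DoubleStar

variable {x y : V}

lemma doubleStar_leaf {v : V}
    (hv : v ∈ (G.neighborFinset x).erase y) : doubleStar G x y v = 1 := by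
  simp only [mem_erase, mem_neighborFinset] at hv
  have : v ≠ x := hv.2.ne'
  simp [doubleStar, hv.1, hv.2, this]

lemma sum_doubleStar_centre (hxy : G.Adj x y) (hx : G.degree x = 3) :
    ∑ j ∈ G.neighborFinset x, doubleStar G x y j = 2 * doubleStar G x y x := by
  have hy : y ∈ G.neighborFinset x := by simpa using hxy
  rw [← add_sum_erase _ _ hy, sum_congr rfl fun v hv => doubleStar_leaf hv, sum_const,
    card_erase_of_mem hy, card_neighborFinset_eq_degree, hx]
  simp [doubleStar]

lemma sum_doubleStar_leaf (hG : G.CliqueFree 3) (hxy : G.Adj x y)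
    (hno : ∀ u v, G.Adj x u → G.Adj y v → u ≠ y → v ≠ x → ¬ G.Adj u v) {v : V}
    (hv : v ∈ (G.neighborFinset x).erase y) :
    ∑ j ∈ G.neighborFinset v, doubleStar G x y j = 2 * doubleStar G x y v := by
  rw [doubleStar_leaf hv]
  simp only [mem_erase, mem_neighborFinset] at hv
  have hx : x ∈ G.neighborFinset v := by simpa using hv.2.symm
  have hz : ∑ j ∈ (G.neighborFinset v).erase x, doubleStar G x y j = 0 := by
    refine sum_eq_zero fun j hj => ?_
    simp only [mem_erase, mem_neighborFinset] at hj
    have h1 : j ≠ y := by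
      rintro rfl
      exact not_adj_of_adj_of_adj hG hv.2 hxy hj.2
    have h2 : ¬ G.Adj x j := fun h => not_adj_of_adj_of_adj hG hv.2 h hj.2
    have h3 : ¬ G.Adj y j := fun h => hno v j hv.2 h hv.1 hj.1 hj.2
    simp [doubleStar, hj.1, h1, h2, h3]
  rw [← add_sum_erase _ _ hx, hz]
  simp [doubleStar]

lemma card_sdiff_leaf_le (h3 : ∀ v, G.degree v ≤ 3) (F : Finset V) (hxF : x ∈ F) {v : V}
    (hv : v ∈ (G.neighborFinset x).erase y) : #(G.neighborFinset v \ F) ≤ 2 := by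
  simp only [mem_erase, mem_neighborFinset] at hv
  have hxv : x ∈ G.neighborFinset v := by simpa using hv.2.symm
  have h1 : G.neighborFinset v \ F ⊆ (G.neighborFinset v).erase x := by
    rw [← sdiff_singleton_eq_erase]
    exact sdiff_subset_sdiff subset_rfl (by simpa using hxF)
  have h2 := card_le_card h1
  rw [card_erase_of_mem hxv, card_neighborFinset_eq_degree] at h2
  have := h3 v
  omega

/-- The two vertices and their four leaves form an affine `D₅`, induced because a quadrangle would
be needed to join leaves at different ends. `affine_bound` would give 370 ≤ 346 or 304 ≤ 284. -/
lemma degree_ne_three_of_adj (hG : G.CliqueFree 3) (hq : FormNonneg G)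
    (hn : Fintype.card V = 66) (hα : ∀ I : Finset V, G.IsIndepSet I → #I ≤ 26)
    (h3 : ∀ v, G.degree v ≤ 3) (hxy : G.Adj x y) (hx : G.degree x = 3) : G.degree y ≠ 3 := by
  intro hy
  have hno : ∀ u v, G.Adj x u → G.Adj y v → u ≠ y → v ≠ x → ¬ G.Adj u v :=
    fun u v h1 h2 h4 h5 => not_adj_of_quadrangle hG hq hn hα h3 hxy h1 h2 h4 h5
  have hno' : ∀ u v, G.Adj y u → G.Adj x v → u ≠ x → v ≠ y → ¬ G.Adj u v :=
    fun u v h1 h2 h4 h5 h => hno v u h2 h1 h5 h4 h.symm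
  set X := (G.neighborFinset x).erase y with hX
  set Y := (G.neighborFinset y).erase x with hY
  have hyx : y ∈ G.neighborFinset x := by simpa using hxy
  have hxy' : x ∈ G.neighborFinset y := by simpa using hxy.symm
  have hXc : #X = 2 := by rw [hX, card_erase_of_mem hyx, card_neighborFinset_eq_degree, hx]
  have hYc : #Y = 2 := by rw [hY, card_erase_of_mem hxy', card_neighborFinset_eq_degree, hy]
  have hXY : Disjoint X Y := by
    rw [Finset.disjoint_left]
    intro a ha hb
    simp only [hX, hY, mem_erase, mem_neighborFinset] at ha hb
    exact not_adj_of_adj_of_adj hG hxy ha.2 hb.2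
  have hxF : x ∉ insert y (X ∪ Y) := by simp [hX, hY, hxy.ne]
  have hyF : y ∉ X ∪ Y := by simp [hX, hY]
  set F := insert x (insert y (X ∪ Y)) with hF
  have hFe : G.neighborFinset x ∪ G.neighborFinset y = F := by
    ext a
    simp only [hF, hX, hY, mem_union, mem_insert, mem_erase, mem_neighborFinset]
    constructor
    · rintro (h | h)
      · by_cases a = y <;> tauto
      · by_cases a = x <;> tauto
    · rintro (rfl | rfl | h | h)
      · exact Or.inr hxy.symm
      · exact Or.inl hxy
      · exact Or.inl h.2
      · exact Or.inr h.2
  have hFc : #F = 6 := by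
    rw [hF, card_insert_of_notMem hxF, card_insert_of_notMem hyF, card_union_of_disjoint hXY, hXc,
      hYc]
  have hmem : ∀ v ∈ F, v = x ∨ v = y ∨ v ∈ X ∨ v ∈ Y := fun v hv => by
    simpa only [hF, mem_insert, mem_union] using hv
  have hsum : ∀ f : V → ℕ, ∑ v ∈ F, f v = f x + (f y + (∑ v ∈ X, f v + ∑ v ∈ Y, f v)) := by
    intro f
    rw [hF, sum_insert hxF, sum_insert hyF, sum_union hXY]
  have lX : ∀ v ∈ X, doubleStar G x y v = 1 := fun v hv => doubleStar_leaf hv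
  have lY : ∀ v ∈ Y, doubleStar G x y v = 1 := fun v hv => by
    rw [doubleStar_comm]; exact doubleStar_leaf hv
  have lx : doubleStar G x y x = 2 := by simp [doubleStar]
  have ly : doubleStar G x y y = 2 := by simp [doubleStar]
  have hxF' : x ∈ F := mem_insert_self _ _
  have hyF' : y ∈ F := mem_insert_of_mem (mem_insert_self _ _)
  have := affine_bound (F := F) (e := doubleStar G x y) (M := 8) (K := 8)
    (J := X ∪ Y) (k := 2) hG hq hα h3
    (fun v hv => by
      have h1 : v ≠ x := fun h => hv (h ▸ hxF')
      have h2 : v ≠ y := fun h => hv (h ▸ hyF')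
      rw [← hFe] at hv
      simp only [doubleStar, h1, h2, hv, or_self, if_false])
    (fun v hv => by
      rcases hmem v hv with rfl | rfl | h | h
      · rw [lx]; norm_num
      · rw [ly]; norm_num
      · rw [lX v h]
      · rw [lY v h])
    (fun v hv => by
      rcases hmem v hv with rfl | rfl | h | h
      · exact sum_doubleStar_centre hxy hx
      · rw [doubleStar_comm]; exact sum_doubleStar_centre hxy.symm hy
      · exact sum_doubleStar_leaf hG hxy hno h
      · rw [doubleStar_comm]; exact sum_doubleStar_leaf hG hxy.symm hno' h)
    (by rw [hsum, lx, ly, sum_congr rfl lX, sum_congr rfl lY]; simp [hXc, hYc])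
    (by norm_num)
    (by
      have h1 : G.neighborFinset x \ F = ∅ := by
        rw [sdiff_eq_empty_iff_subset, ← hFe]; exact subset_union_left
      have h2 : G.neighborFinset y \ F = ∅ := by
        rw [sdiff_eq_empty_iff_subset, ← hFe]; exact subset_union_right
      have h3X : ∑ v ∈ X, #(G.neighborFinset v \ F) ≤ #X * 2 :=
        sum_le_card_nsmul _ _ _ fun v hv => card_sdiff_leaf_le h3 F hxF' hv
      have h3Y : ∑ v ∈ Y, #(G.neighborFinset v \ F) ≤ #Y * 2 :=
        sum_le_card_nsmul _ _ _ fun v hv => card_sdiff_leaf_le h3 F hyF' hv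
      rw [hsum, h1, h2, card_empty]
      omega)
    ((subset_insert _ _).trans (subset_insert _ _))
    (by
      rw [coe_union, isIndepSet_iff, Set.pairwise_union]
      refine ⟨fun a ha b hb _ => ?_, fun a ha b hb _ => ?_, fun a ha b hb _ => ?_⟩ <;>
        simp only [hX, hY, mem_coe, mem_erase, mem_neighborFinset] at ha hb
      · exact not_adj_of_adj_of_adj hG ha.2 hb.2
      · exact not_adj_of_adj_of_adj hG ha.2 hb.2
      · have := hno a b ha.2 hb.2 ha.1 hb.1
        exact ⟨this, fun h => this h.symm⟩)
  rw [card_union_of_disjoint hXY, hXc, hYc, hFc, hn] at this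
  omega

end DoubleStar

/-- The main bound: there is no triangle-free graph on `66` vertices with positive semidefinite
form and independence number at most `26`. -/
lemma no_graph_on_sixty_six (hG : G.CliqueFree 3) (hq : FormNonneg G) (hn : Fintype.card V = 66)
    (hα : ∀ I : Finset V, G.IsIndepSet I → #I ≤ 26) : False := by
  have h4 := degree_le_four hG hq hn (degree_ne_thirteen hG hq hn)
  have h3 : ∀ v, G.degree v ≤ 3 := fun v => by
    have := h4 v
    have := degree_ne_four hG hq hn hα h4 v
    omega
  have hd : ∀ v, #(nbrsIn G univ v) = G.degree v := fun v => by
    rw [← card_neighborFinset_eq_degree]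
    congr 1
    ext; simp [mem_nbrsIn]
  obtain ⟨I, -, hI, hc⟩ := exists_indep_of_pairwise_no_adj_cubic hG univ
    (fun v _ => by rw [hd]; exact h3 v)
    (fun v _ u _ huv h => by
      rw [hd] at h ⊢
      exact degree_ne_three_of_adj hG hq hn hα h3 huv h)
  rw [card_univ, hn] at hc
  have := hα I hI
  omega

end LowDegree

/-! ### From the Seidel eigenvalue to the form on 66 vertices. -/

section Reduction

/-- The quadratic form of `S + 5I` is nonnegative. -/
def SeidelNonneg {W : Type*} [Fintype W] (S : Matrix W W ℝ) : Prop :=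
  ∀ v : W → ℝ, 0 ≤ ∑ i, ∑ j, v i * S i j * v j + 5 * ∑ i, v i ^ 2

lemma seidelNonneg_of_smallestEigenvalue {W : Type*} [Fintype W] [DecidableEq W]
    {S : Matrix W W ℝ} (hS : S.IsSymm) (h : -5 ≤ smallestEigenvalue S) : SeidelNonneg S := by
  have hH : S.IsHermitian := by
    rw [Matrix.IsHermitian, Matrix.conjTranspose_eq_transpose_of_trivial]; exact hS
  have hpsd : (S + (5 : ℝ) • (1 : Matrix W W ℝ)).PosSemidef := by
    rw [Matrix.posSemidef_iff_isHermitian_and_spectrum_nonneg]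
    refine ⟨hH.add (Matrix.isHermitian_one.smul (by simp [IsSelfAdjoint])), fun μ hμ => ?_⟩
    have h1 : μ - 5 ∈ spectrum ℝ S := by
      have := spectrum.add_mem_add_iff (R := ℝ) (a := S) (r := μ - 5) (s := 5)
      rw [← this]
      rw [Algebra.algebraMap_eq_smul_one, add_comm, sub_add_cancel]
      exact hμ
    have h2 : sInf (spectrum ℝ S) ≤ μ - 5 := csInf_le Matrix.finite_real_spectrum.bddBelow h1
    unfold smallestEigenvalue at h
    show 0 ≤ μ
    linarith
  intro v
  have h3 := hpsd.dotProduct_mulVec_nonneg v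
  simp only [star_trivial, Matrix.add_mulVec, dotProduct_add, Matrix.smul_mulVec,
    Matrix.one_mulVec, dotProduct_smul, smul_eq_mul] at h3
  have e1 : ∑ i, ∑ j, v i * S i j * v j = v ⬝ᵥ S.mulVec v := by
    simp only [dotProduct, Matrix.mulVec, mul_sum, mul_assoc]
  have e2 : ∑ i, v i ^ 2 = v ⬝ᵥ v := by
    simp only [dotProduct, sq]
  rw [e1, e2]
  exact h3

/-- Passing to a principal submatrix, with sign changes, keeps the form nonnegative. -/
lemma SeidelNonneg.of_submatrix {W X : Type*} [Fintype W] [Fintype X] {S : Matrix W W ℝ}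
    (h : SeidelNonneg S) {T : Matrix X X ℝ} {f : X → W} (hf : f.Injective) {ε : X → ℝ}
    (hε : ∀ i, ε i ^ 2 = 1) (hT : ∀ i j, T i j = ε i * S (f i) (f j) * ε j) : SeidelNonneg T := by
  classical
  intro v
  let u : W → ℝ := fun w => ∑ x, if f x = w then ε x * v x else 0
  have hu : ∀ g : W → ℝ, ∑ w, u w * g w = ∑ x, ε x * v x * g (f x) := by
    intro g
    simp only [u, sum_mul, ite_mul, zero_mul]
    rw [sum_comm]
    simp
  have huf : ∀ x, u (f x) = ε x * v x := by
    intro x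
    simp only [u, hf.eq_iff]
    simp
  have := h u
  have h1 : ∑ i, ∑ j, u i * S i j * u j = ∑ i, ∑ j, v i * T i j * v j := by
    have : ∀ i, ∑ j, u i * S i j * u j = u i * ∑ j, u j * S i j := fun i => by
      rw [mul_sum]; exact sum_congr rfl fun j _ => by ring
    simp only [this, hu]
    refine sum_congr rfl fun i _ => ?_
    rw [mul_sum]
    refine sum_congr rfl fun j _ => ?_
    rw [hT]; ring
  have h2 : ∑ i, u i ^ 2 = ∑ i, v i ^ 2 := by
    have h3 := hu u
    simp only [← sq] at h3
    rw [h3]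
    simp only [huf]
    refine Finset.sum_congr rfl fun i _ => ?_
    have := hε i
    linear_combination v i * v i * this
  rwa [h1, h2] at this

open Classical in
lemma seidelMatrix_apply {V : Type*} [Fintype V] [DecidableEq V] (G : SimpleGraph V) (i j : V) :
    seidelMatrix G i j = if i = j then 0 else if G.Adj i j then -1 else 1 := by
  by_cases h : i = j
  · subst h; simp [seidelMatrix]
  · by_cases h2 : G.Adj i j
    · simp [seidelMatrix, h, h2]; norm_num
    · simp [seidelMatrix, h, h2]

lemma seidelMatrix_congr {V W : Type*} [Fintype V] [DecidableEq V] [Fintype W] [DecidableEq W]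
    {G : SimpleGraph V} {H : SimpleGraph W} {i j : V} {i' j' : W} (h : i = j ↔ i' = j')
    (hadj : G.Adj i j ↔ H.Adj i' j') : seidelMatrix G i j = seidelMatrix H i' j' := by
  rw [seidelMatrix_apply, seidelMatrix_apply]
  by_cases h1 : i = j
  · rw [if_pos h1, if_pos (h.1 h1)]
  · rw [if_neg h1, if_neg (mt h.2 h1)]
    by_cases h2 : G.Adj i j
    · rw [if_pos h2, if_pos (hadj.1 h2)]
    · rw [if_neg h2, if_neg (mt hadj.2 h2)]

lemma seidelMatrix_isSymm {V : Type*} [Fintype V] [DecidableEq V] (G : SimpleGraph V) :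
    (seidelMatrix G).IsSymm := by
  ext i j
  exact seidelMatrix_congr eq_comm (G.adj_comm j i)

lemma formNonneg_of_seidelNonneg {V : Type*} [Fintype V] [DecidableEq V] {G : SimpleGraph V}
    [DecidableRel G.Adj] (h : SeidelNonneg (seidelMatrix (G ⊕g twoK2))) : FormNonneg G := by
  intro v
  set s := ∑ i, v i with hs
  -- A constant `c` on the four extra vertices contributes `24c² + 8sc`, least at `c = -s/6`.
  have h1 := h (Sum.elim v fun _ => -s / 6)
  have e1 : ∀ i j, seidelMatrix (G ⊕g twoK2) (Sum.inl i) (Sum.inl j) = seidelMatrix G i j := by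
    intro i j
    exact seidelMatrix_congr Sum.inl_injective.eq_iff sum_adj_inl
  have e2 : ∀ i j, seidelMatrix (G ⊕g twoK2) (Sum.inl i) (Sum.inr j) = 1 := by
    intro i j; simp [seidelMatrix_apply]
  have e3 : ∀ i j, seidelMatrix (G ⊕g twoK2) (Sum.inr i) (Sum.inl j) = 1 := by
    intro i j; simp [seidelMatrix_apply]
  have e4 : ∑ i, ∑ j, seidelMatrix (G ⊕g twoK2) (Sum.inr i) (Sum.inr j) = 4 := by
    simp [seidelMatrix_apply, Fintype.sum_sum_type, Fin.sum_univ_two]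
    norm_num
  have e5 : ∑ i, ∑ j, v i * seidelMatrix G i j * v j =
      s ^ 2 - ∑ i, v i ^ 2 - 2 * ∑ i, v i * ∑ j ∈ G.neighborFinset i, v j := by
    have hrow : ∀ i, ∑ j, v i * seidelMatrix G i j * v j =
        v i * s - v i ^ 2 - 2 * (v i * ∑ j ∈ G.neighborFinset i, v j) := by
      intro i
      have hj : ∀ j, v i * seidelMatrix G i j * v j = v i * v j
          - (if i = j then v i * v j else 0) - 2 * (v i * if j ∈ G.neighborFinset i then v j else 0) := by
        intro j
        rw [seidelMatrix_apply]
        by_cases h1 : i = j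
        · subst h1; simp
        · by_cases h2 : G.Adj i j <;> simp [h1, h2]
          ring
      simp only [hj, sum_sub_distrib, ← mul_sum, sum_ite_mem, univ_inter, sum_ite_eq, mem_univ,
        if_true, hs]
      ring
    simp only [hrow, sum_sub_distrib, ← mul_sum, ← sum_mul, hs]
    ring
  simp only [Fintype.sum_sum_type (α₁ := V), Sum.elim_inl, Sum.elim_inr, e1, e2, e3,
    sum_add_distrib, e5, mul_one, ← mul_sum, ← sum_mul, e4, ← hs] at h1
  simp only [sum_const, card_univ, Fintype.card_sum, Fintype.card_fin, nsmul_eq_mul] at h1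
  push_cast at h1
  linarith

/-- A graph on `66` vertices whose union with two edges is, up to switching, an induced subgraph
of a graph with smallest Seidel eigenvalue at least `-5`. -/
lemma not_exists_embedding {P W : Type*} [Fintype P] [DecidableEq P] [Fintype W] {S : Matrix W W ℝ}
    (hS : SeidelNonneg S) {K : SimpleGraph P} (hP : Fintype.card P = 66) (hK : K.CliqueFree 3)
    (hα : ∀ I : Finset P, K.IsIndepSet I → #I ≤ 26) {f : P ⊕ (Fin 2 ⊕ Fin 2) → W}
    (hf : f.Injective) {ε : P ⊕ (Fin 2 ⊕ Fin 2) → ℝ} (hε : ∀ i, ε i ^ 2 = 1)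
    (hT : ∀ i j, seidelMatrix (K ⊕g twoK2) i j = ε i * S (f i) (f j) * ε j) : False := by
  classical
  exact no_graph_on_sixty_six hK (formNonneg_of_seidelNonneg (hS.of_submatrix hf hε hT)) hP hα

lemma card_le_sixty_five {V : Type*} [Fintype V] [DecidableEq V] {G : SimpleGraph V}
    (hG : G.CliqueFree 3) (hS : -5 ≤ smallestEigenvalue (seidelMatrix (G ⊕g twoK2)))
    (hα : G.indepNum ≤ 26) : Fintype.card V ≤ 65 := by
  by_contra! hcard
  obtain ⟨s, -, hs⟩ := exists_subset_card_eq (s := (univ : Finset V)) (n := 66) (by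
    rw [card_univ]; omega)
  have hinj : Function.Injective (Sum.map Subtype.val id : s ⊕ (Fin 2 ⊕ Fin 2) → _) :=
    Subtype.val_injective.sumMap Function.injective_id
  refine not_exists_embedding (P := s) (K := G.induce s)
    (seidelNonneg_of_smallestEigenvalue (seidelMatrix_isSymm _) hS)
    (by simpa using hs) (hG.comap (Embedding.induce _).isContained)
    (fun I hI => ?_) hinj (ε := fun _ => 1) (by simp) (fun i j => ?_)
  · refine le_trans ?_ hα
    rw [← card_map (Function.Embedding.subtype _)]
    apply IsIndepSet.card_le_indepNum
    intro a ha b hb hab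
    simp only [coe_map, Set.mem_image, mem_coe] at ha hb
    obtain ⟨a, ha, rfl⟩ := ha
    obtain ⟨b, hb, rfl⟩ := hb
    exact hI ha hb fun h => hab (by rw [h])
  · rw [one_mul, mul_one]
    refine seidelMatrix_congr hinj.eq_iff.symm ?_
    rcases i with i | i <;> rcases j with j | j <;>
      simp

end Reduction

/-! ### Pillars and switching. -/

section Pillar

variable {V : Type*}

lemma graphOfSeidel_adj {S : Matrix V V ℝ} (hS : S.IsSymm) {i j : V} :
    (graphOfSeidel S).Adj i j ↔ i ≠ j ∧ S i j = -1 := by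
  rw [graphOfSeidel, fromRel_adj, hS.apply i j, or_self]

variable [DecidableEq V]

/-- The sign by which the switching diagonal scales a coordinate. -/
noncomputable def switchingSign (U : Finset V) (i : V) : ℝ := if i ∈ U then 1 else -1

lemma switchingSign_eq (U : Finset V) (i : V) : switchingSign U i = 1 ∨ switchingSign U i = -1 := by
  unfold switchingSign; split_ifs <;> simp

variable [Fintype V]

lemma switchSeidel_apply (S : Matrix V V ℝ) (U : Finset V) (i j : V) :
    switchSeidel S U i j = switchingSign U i * S i j * switchingSign U j := by
  simp [switchSeidel, switchingDiagonal, switchingSign, Matrix.mul_diagonal, Matrix.diagonal_mul]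

lemma IsSeidelMatrix.switchSeidel {S : Matrix V V ℝ} (hS : IsSeidelMatrix S) (U : Finset V) :
    IsSeidelMatrix (switchSeidel S U) where
  isSymm := by
    ext i j
    rw [Matrix.transpose_apply, switchSeidel_apply, switchSeidel_apply, hS.isSymm.apply i j]
    ring
  diag_eq_zero i := by rw [switchSeidel_apply, hS.diag_eq_zero]; ring
  off_diag i j hij := by
    rw [switchSeidel_apply]
    rcases switchingSign_eq U i with h1 | h1 <;> rcases switchingSign_eq U j with h2 | h2 <;>
      rcases hS.off_diag i j hij with h3 | h3 <;> simp [h1, h2, h3]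

lemma IsSeidelMatrix.seidelMatrix_graphOfSeidel {S : Matrix V V ℝ} (hS : IsSeidelMatrix S) :
    seidelMatrix (graphOfSeidel S) = S := by
  ext i j
  rw [seidelMatrix_apply]
  by_cases hij : i = j
  · rw [if_pos hij, hij, hS.diag_eq_zero]
  · rw [if_neg hij]
    rcases hS.off_diag i j hij with h | h
    · rw [if_neg, h]
      rw [graphOfSeidel_adj hS.isSymm, h]
      norm_num
    · rw [if_pos, h]
      rw [graphOfSeidel_adj hS.isSymm]
      exact ⟨hij, h⟩

/-- A set of indices on which all signed off-diagonal entries of `S` are `1` gives an independent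
set of the switching graph. -/
lemma card_le_switchingIndepNum {S : Matrix V V ℝ} (hS : IsSeidelMatrix S) (J : Finset V)
    (D : V → ℝ) (hD : ∀ i, D i = 1 ∨ D i = -1)
    (hJ : ∀ i ∈ J, ∀ j ∈ J, i ≠ j → D i * S i j * D j = 1) : #J ≤ switchingIndepNum S := by
  classical
  -- The sign selects the copy of the index; the off-diagonal blocks of the switching graph supply
  -- the factor -1 between different signs.
  let φ : V → V ⊕ V := fun i => if D i = 1 then Sum.inl i else Sum.inr i
  have hφ : φ.Injective := by
    intro i j hij
    simp only [φ] at hij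
    split_ifs at hij <;> simpa using hij
  rw [← card_image_of_injective J hφ]
  apply IsIndepSet.card_le_indepNum
  intro a ha b hb hab
  simp only [coe_image, Set.mem_image, mem_coe] at ha hb
  obtain ⟨i, hi, rfl⟩ := ha
  obtain ⟨j, hj, rfl⟩ := hb
  have hij : i ≠ j := fun h => hab (by rw [h])
  have h := hJ i hi j hj hij
  have hsymm := hS.isSymm.apply i j
  rw [switchingGraph, graphOfSeidel, fromRel_adj]
  rintro ⟨-, h'⟩
  simp only [φ] at h'
  rcases hD i with h1 | h1 <;> rcases hD j with h2 | h2 <;>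
    norm_num [h1, h2, hsymm, hij, hij.symm, Matrix.one_apply] at h h' <;> linarith

lemma pillar_card_le {S : Matrix V V ℝ} (hS : IsSeidelMatrix S) (h5 : smallestEigenvalue S = -5)
    (hα : switchingIndepNum S ≤ 28) {G : SimpleGraph V} (hG : G ∈ switchingClass S)
    (hω : G.cliqueNum = 4) {B : Finset V} (hB : G.IsNClique 4 B) {U : Finset V} (hUB : U ⊆ B)
    (hU : #U = 2) : (pillar G B U).ncard ≤ 65 := by
  classical
  by_contra! hcard
  obtain ⟨U₀, rfl⟩ := hG
  set S' := switchSeidel S U₀ with hS'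
  have hSS := hS.switchSeidel U₀
  set G := graphOfSeidel S' with hG
  have hmat : seidelMatrix G = S' := hSS.seidelMatrix_graphOfSeidel
  have hnn : SeidelNonneg S' :=
    (seidelNonneg_of_smallestEigenvalue hS.isSymm h5.ge).of_submatrix (f := id)
      Function.injective_id (ε := switchingSign U₀)
      (fun i => by rcases switchingSign_eq U₀ i with h | h <;> rw [h] <;> norm_num)
      (fun i j => switchSeidel_apply S U₀ i j)
  have hadj : ∀ {i j}, G.Adj i j → S' i j = -1 := fun h =>
    ((graphOfSeidel_adj hSS.isSymm).1 h).2
  have hnadj : ∀ {i j}, i ≠ j → ¬ G.Adj i j → S' i j = 1 := fun hij h =>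
    (hSS.off_diag _ _ hij).resolve_right fun h' => h ((graphOfSeidel_adj hSS.isSymm).2 ⟨hij, h'⟩)
  obtain ⟨s, hsp, hs⟩ := Set.exists_subset_card_eq (s := pillar G B U) (n := 66) (by omega)
  set t : Finset V := univ.filter (· ∈ s) with ht
  have htc : #t = 66 := by
    rw [← hs, Set.ncard_eq_toFinset_card']
    congr 1
    ext; simp [ht]
  have htp : ∀ p ∈ t, p ∈ pillar G B U := fun p hp => hsp (mem_filter.1 hp).2
  obtain ⟨u₀, u₁, hu, hUe⟩ := card_eq_two.1 hU
  obtain ⟨b₀, b₁, hb, hBe⟩ := card_eq_two.1 (show #(B \ U) = 2 by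
    rw [card_sdiff_of_subset hUB, hB.card_eq, hU])
  have hu₀ : u₀ ∈ U := by simp [hUe]
  have hu₁ : u₁ ∈ U := by simp [hUe]
  have hb₀ : b₀ ∈ B \ U := by simp [hBe]
  have hb₁ : b₁ ∈ B \ U := by simp [hBe]
  have hub : ∀ u ∈ U, ∀ b ∈ B \ U, u ≠ b := fun u hu b hb h =>
    (mem_sdiff.1 hb).2 (h ▸ hu)
  have hpB : ∀ p ∈ t, ∀ b ∈ B, p ≠ b := fun p hp b hb h => (htp p hp).1 (h ▸ hb)
  have hBB : ∀ a ∈ B, ∀ b ∈ B, a ≠ b → S' a b = -1 := fun a ha b hb hab =>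
    hadj (hB.isClique ha hb hab)
  have hpu : ∀ p ∈ t, ∀ u ∈ U, S' p u = -1 := fun p hp u hu => hadj ((htp p hp).2.1 u hu)
  have hpb : ∀ p ∈ t, ∀ b ∈ B \ U, S' p b = 1 := fun p hp b hb =>
    hnadj (hpB p hp b (mem_sdiff.1 hb).1) ((htp p hp).2.2 b hb)
  have hcomm : ∀ i j, S' j i = S' i j := fun i j => hSS.isSymm.apply i j
  let f : t ⊕ (Fin 2 ⊕ Fin 2) → V := Sum.elim Subtype.val (Sum.elim ![u₀, u₁] ![b₀, b₁])
  -- Switching `U` makes it non-adjacent to the pillar and to `B \ U`, while the edges inside `U`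
  -- and inside `B \ U` survive.
  let ε : t ⊕ (Fin 2 ⊕ Fin 2) → ℝ := Sum.elim (fun _ => 1) (Sum.elim (fun _ => -1) fun _ => 1)
  have hfU : ∀ k, ![u₀, u₁] k ∈ U := fun k => by fin_cases k <;> assumption
  have hfB : ∀ k, ![b₀, b₁] k ∈ B \ U := fun k => by fin_cases k <;> assumption
  have hfu : Function.Injective ![u₀, u₁] := by
    intro i j h; fin_cases i <;> fin_cases j <;> simp_all
  have hfb : Function.Injective ![b₀, b₁] := by
    intro i j h; fin_cases i <;> fin_cases j <;> simp_all
  have hf : f.Injective := by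
    refine Subtype.val_injective.sumElim (hfu.sumElim hfb fun i j => hub _ (hfU i) _ (hfB j)) ?_
    rintro ⟨p, hp⟩ (i | i)
    · exact hpB p hp _ (hUB (hfU i))
    · exact hpB p hp _ (mem_sdiff.1 (hfB i)).1
  refine not_exists_embedding (P := t) (K := G.induce t) hnn (by simpa using htc) ?_ ?_ hf
    (ε := ε) ?_ ?_
  · intro c hc
    -- A triangle in the pillar together with `U` would be a 5-clique.
    have hclique : G.IsClique (c.map (Function.Embedding.subtype _) ∪ U : Finset V) := by
      rw [coe_union, isClique_iff, Set.pairwise_union]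
      refine ⟨?_, fun a ha b hb hab => hB.isClique (hUB ha) (hUB hb) hab, ?_⟩
      · intro a ha b hb hab
        simp only [coe_map, Set.mem_image, mem_coe] at ha hb
        obtain ⟨a, ha, rfl⟩ := ha
        obtain ⟨b, hb, rfl⟩ := hb
        exact hc.isClique ha hb fun h => hab (by rw [h])
      · intro a ha b hb _
        simp only [coe_map, Set.mem_image, mem_coe] at ha hb
        obtain ⟨a, -, rfl⟩ := ha
        have := (htp a a.2).2.1 b hb
        exact ⟨this, this.symm⟩
    have hcard := hclique.card_le_cliqueNum
    rw [card_union_of_disjoint, card_map, hc.card_eq, hU, hω] at hcard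
    · omega
    · rw [Finset.disjoint_left]
      intro a ha haU
      obtain ⟨a, -, rfl⟩ := mem_map.1 ha
      exact hpB a a.2 a (hUB haU) rfl
  · intro I hI
    set I' := I.map (Function.Embedding.subtype (· ∈ t)) with hI'
    have hI't : ∀ p ∈ I', p ∈ t := by
      intro p hp
      obtain ⟨p, -, rfl⟩ := mem_map.1 hp
      exact p.2
    have hII : ∀ p ∈ I', ∀ q ∈ I', p ≠ q → S' p q = 1 := by
      intro p hp q hq hpq
      obtain ⟨p, hpI, rfl⟩ := mem_map.1 hp
      obtain ⟨q, hqI, rfl⟩ := mem_map.1 hq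
      exact hnadj hpq (hI hpI hqI fun h => hpq (by rw [h]))
    have hb₀I : b₀ ∉ I' := fun h => hpB _ (hI't _ h) _ (mem_sdiff.1 hb₀).1 rfl
    have hu₀I : u₀ ∉ insert b₀ I' := by
      rw [mem_insert, not_or]
      exact ⟨hub _ hu₀ _ hb₀, fun h => hpB _ (hI't _ h) _ (hUB hu₀) rfl⟩
    have hub₀ : S' u₀ b₀ = -1 :=
      hBB _ (hUB hu₀) _ (mem_sdiff.1 hb₀).1 (hub _ hu₀ _ hb₀)
    have hne : ∀ p ∈ I', p ≠ u₀ := fun p hp => hpB p (hI't p hp) _ (hUB hu₀)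
    have hbu : b₀ ≠ u₀ := (hub _ hu₀ _ hb₀).symm
    -- After switching `u₀`, an independent set of the pillar extends by `u₀` and `b₀`; hence 28
    -- becomes 26.
    have key := card_le_switchingIndepNum hS (insert u₀ (insert b₀ I'))
      (fun i => switchingSign U₀ i * if i = u₀ then -1 else 1)
      (fun i => by rcases switchingSign_eq U₀ i with h | h <;> rw [h] <;> split_ifs <;> simp)
      (fun i hi j hj hij => by
        have hre : ∀ a b : ℝ, switchingSign U₀ i * a * S i j * (switchingSign U₀ j * b) =
            a * S' i j * b := fun a b => by rw [hS', switchSeidel_apply]; ring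
        rw [hre]
        simp only [mem_insert] at hi hj
        rcases hi with rfl | rfl | hi <;> rcases hj with rfl | rfl | hj
        · exact absurd rfl hij
        · simp [hbu, hub₀]
        · simp [hne j hj, hcomm j, hpu j (hI't j hj) _ hu₀]
        · simp [hbu, hcomm j, hub₀]
        · exact absurd rfl hij
        · simp [hne j hj, hbu, hcomm j, hpb j (hI't j hj) _ hb₀]
        · simp [hne i hi, hpu i (hI't i hi) _ hu₀]
        · simp [hne i hi, hbu, hpb i (hI't i hi) _ hb₀]
        · simp [hne i hi, hne j hj, hII i hi j hj hij])
    rw [card_insert_of_notMem hu₀I, card_insert_of_notMem hb₀I, hI', card_map] at key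
    omega
  · rintro (i | i | i) <;> simp [ε]
  · have hdiag : ∀ i, S' i i = 0 := hSS.diag_eq_zero
    have huu := hBB _ (hUB hu₀) _ (hUB hu₁) hu
    have hbb := hBB _ (mem_sdiff.1 hb₀).1 _ (mem_sdiff.1 hb₁).1 hb
    have hub' : ∀ k l, S' (![u₀, u₁] k) (![b₀, b₁] l) = -1 := fun k l =>
      hBB _ (hUB (hfU k)) _ (mem_sdiff.1 (hfB l)).1 (hub _ (hfU k) _ (hfB l))
    rintro (p | k | k) (q | l | l)
    · simp only [ε, f, Sum.elim_inl, one_mul, mul_one]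
      rw [← hmat]
      exact seidelMatrix_congr (Sum.inl_injective.eq_iff.trans Subtype.val_injective.eq_iff.symm) (by simp)
    · simp [ε, f, seidelMatrix_apply, hpu p p.2 _ (hfU l)]
    · simp [ε, f, seidelMatrix_apply, hpb p p.2 _ (hfB l)]
    · simp [ε, f, seidelMatrix_apply, hcomm q, hpu q q.2 _ (hfU k)]
    · fin_cases k <;> fin_cases l <;>
        simp [ε, f, seidelMatrix_apply, hdiag, huu, hcomm u₀ u₁]
    · simp [ε, f, seidelMatrix_apply, hub' k l]
    · simp [ε, f, seidelMatrix_apply, hcomm q, hpb q q.2 _ (hfB k)]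
    · simp [ε, f, seidelMatrix_apply, hcomm _ (![b₀, b₁] k), hub' l k]
    · fin_cases k <;> fin_cases l <;>
        simp [ε, f, seidelMatrix_apply, hdiag, hbb, hcomm b₀ b₁]

end Pillar

/-- Both parts follow from the sharp bound `65` on the number of vertices (attained by thirteen
disjoint pentagons), which is proved in `no_graph_on_sixty_six`. -/
theorem mainTheorem8 {V : Type*} [Fintype V] [DecidableEq V] :
    (∀ G : SimpleGraph V, G.CliqueFree 3 →
        -5 ≤ smallestEigenvalue (seidelMatrix (G ⊕g twoK2)) →
        G.indepNum ≤ 26 →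
        Fintype.card V ≤ 68 ∧
          (66 ≤ Fintype.card V → ∃ x y : V, G.Adj x y ∧ valency G x + valency G y ≤ 20)) ∧
    (∀ S : Matrix V V ℝ, IsSeidelMatrix S → smallestEigenvalue S = -5 →
        switchingCliqueNum S = 4 → switchingIndepNum S ≤ 28 →
        ∀ G ∈ switchingClass S, G.cliqueNum = 4 →
        ∀ B : Finset V, G.IsNClique 4 B →
        ∀ U ⊆ B, U.card = 2 →
        (pillar G B U).ncard ≤ 68 ∧
          (66 ≤ (pillar G B U).ncard →
            ∀ x y : pillar G B U, (G.induce (pillar G B U)).Adj x y →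
              valency (G.induce (pillar G B U)) x + valency (G.induce (pillar G B U)) y ≤ 20)) := by
  refine ⟨fun G hG hS hα => ?_, fun S hS h5 _ hα G hG hω B hB U hUB hU => ?_⟩
  · have := card_le_sixty_five hG hS hα
    exact ⟨by omega, fun h => by omega⟩
  · have := pillar_card_le hS h5 hα hG hω hB hUB hU
    exact ⟨by omega, fun h => by omega⟩
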